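/- **Theorem.** Let $d\ge 0$ and $N\ge 1$ be integers, let $R>0$ and $h>0$, and let $\pi:\mathbb{R}^d\to(0,\infty)$ be a continuous positive function (a possibly unnormalised target density) with $$\sup_{x\in\mathbb{R}^d}\pi(x)\,(R^2+\|x\|^2)^d<\infty .$$ Let $\mathbb{S}^d\subset\mathbb{R}^{d+1}$ be the unit sphere with north pole $\mathscr{N}=(0,\dots,0,1)$, and let $\mathrm{SP}:\mathbb{S}^d\setminus\{\mathscr{N}\}\to\mathbb{R}^d$, $\mathrm{SP}(z)=\bigl(R\tfrac{z_1}{1-z_{d+1}},\dots,R\tfrac{z_d}{1-z_{d+1}}\bigr)$, be stereographic projection, with inverse $$\mathrm{SP}^{-1}(x)=\Bigl(\tfrac{2Rx_1}{\|x\|^2+R^2},\dots,\tfrac{2Rx_d}{\|x\|^2+R^2},\tfrac{\|x\|^2-R^2}{\|x\|^2+R^2}\Bigr).$$ Put $\pi_S(z)=\pi(x)(R^2+\|x\|^2)^d$ with $x=\mathrm{SP}(z)$ (at $\mathscr{N}$ put $\mathrm{SP}(\mathscr{N})=0$; this point is never proposed, almost surely). For $z\in\mathbb{S}^d$ let $Q_S(z,\cdot)$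 be the law of $\frac{z+\mathrm{d}z}{\|z+\mathrm{d}z\|}$, where $\mathrm{d}z=\xi-(z^T\xi)z$ and $\xi\sim\mathcal{N}(0,h^2I_{d+1})$. Let the weight function $\omega$ be either globally balanced, $\omega(z,\hat z)=\pi_S(\hat z)/\pi_S(z)$, or locally balanced, $\omega(z,\hat z)=\sqrt{\pi_S(\hat z)/\pi_S(z)}$. Stereographic multiple-try Metropolis (SMTM) with $N$ candidates is the Markov chain on $\mathbb{R}^d$ whose transition from $x$ is as follows. Let $z=\mathrm{SP}^{-1}(x)$. Draw $\hat z_1,\dots,\hat z_N$ independently from $Q_S(z,\cdot)$. Select an index $j$ with probability $\omega(z,\hat z_j)/\sum_{i=1}^N\omega(z,\hat z_i)$. Draw $z^*_1,\dots,z^*_{N-1}$ independently from $Q_S(\hat z_j,\cdot)$. Move to $\mathrm{SP}(\hat z_j)$ with probability $$\alpha=1\wedge\frac{\pi_S(\hat z_j)\,\omega(\hat z_j,z)\big/\bigl(\sum_{i=1}^{N-1}\omega(\hat z_j,z^*_i)+\omega(\hat z_j,z)\bigr)}{\pi_S(z)\,\omega(z,\hat z_j)\big/\sum_{i=1}^{N}\omega(z,\hat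 z_i)},$$ and stay at $x$ otherwise. Let $P$ be the transition kernel of this chain, and let $\bar\pi$ be the measure on $\mathbb{R}^d$ with density $\pi/\int_{\mathbb{R}^d}\pi$. Then, for either choice of $\omega$, SMTM is uniformly ergodic: for every $\varepsilon>0$ there is an $n\in\mathbb{N}$ such that $$\|P^n(x,\cdot)-\bar\pi\|_{\mathrm{TV}}\le\varepsilon\qquad\text{for all }x\in\mathbb{R}^d,$$ where $\|\mu-\nu\|_{\mathrm{TV}}=\sup_A|\mu(A)-\nu(A)|$ over Borel sets $A$. -/

import Mathlib

open MeasureTheory ProbabilityTheory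

namespace SMTM

noncomputable section

/-- Euclidean space `ℝ^d`, with the Euclidean norm. -/
abbrev Euc (d : ℕ) : Type := EuclideanSpace ℝ (Fin d)

/-- The unit sphere `𝕊^d` in `ℝ^(d+1)`. -/
abbrev Sph (d : ℕ) : Type := Metric.sphere (0 : Euc (d + 1)) 1

/-! ### Stereographic projection -/

/-- Stereographic projection `z ↦ (R z₁ / (1 - z_{d+1}), …, R z_d / (1 - z_{d+1}))`. At the north
pole, where it is not defined mathematically, the value is `0` by the convention for division. -/
def stereo {d : ℕ} (R : ℝ) (z : Sph d) : Euc d :=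
  WithLp.toLp 2 fun i => R * (z.1 i.castSucc / (1 - z.1 (Fin.last d)))

/-- The vector
`(2 R x₁ / (‖x‖² + R²), …, 2 R x_d / (‖x‖² + R²), (‖x‖² - R²) / (‖x‖² + R²))` of `ℝ^(d+1)`. -/
def stereoInvVec {d : ℕ} (R : ℝ) (x : Euc d) : Euc (d + 1) :=
  WithLp.toLp 2 (Fin.snoc (α := fun _ => ℝ)
    (fun i => 2 * R * x i / (‖x‖ ^ 2 + R ^ 2)) ((‖x‖ ^ 2 - R ^ 2) / (‖x‖ ^ 2 + R ^ 2)))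

theorem norm_stereoInvVec {d : ℕ} {R : ℝ} (hR : 0 < R) (x : Euc d) : ‖stereoInvVec R x‖ = 1 := by
  have hp : 0 < ‖x‖ ^ 2 + R ^ 2 := by positivity
  have h : ‖stereoInvVec R x‖ ^ 2 = 1 := by
    have hx : ∑ i, x i ^ 2 = ‖x‖ ^ 2 := (EuclideanSpace.real_norm_sq_eq x).symm
    rw [EuclideanSpace.real_norm_sq_eq, Fin.sum_univ_castSucc]
    simp only [stereoInvVec, Fin.snoc_castSucc, Fin.snoc_last, div_pow, mul_pow]
    rw [← Finset.sum_div, ← Finset.mul_sum, hx]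
    field_simp
    ring
  nlinarith [norm_nonneg (stereoInvVec R x)]

/-- Inverse stereographic projection `ℝ^d → 𝕊^d`. -/
def stereoInv {d : ℕ} (R : ℝ) (hR : 0 < R) (x : Euc d) : Sph d :=
  ⟨stereoInvVec R x, by simpa using norm_stereoInvVec hR x⟩

theorem measurable_stereo {d : ℕ} (R : ℝ) : Measurable (stereo (d := d) R) := by
  refine (WithLp.measurable_toLp 2 _).comp (measurable_pi_lambda _ fun i => ?_)
  have h (j : Fin (d + 1)) : Measurable fun z : Sph d => z.1 j := by fun_prop
  have h1 : Measurable fun z : Sph d => 1 - z.1 (Fin.last d) :=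
    (h (Fin.last d)).const_sub (1 : ℝ)
  exact Measurable.const_mul (Measurable.div (h i.castSucc) h1) R

theorem measurable_stereoInv {d : ℕ} (R : ℝ) (hR : 0 < R) :
    Measurable (stereoInv (d := d) R hR) := by
  refine Measurable.subtype_mk ?_
  refine (WithLp.measurable_toLp 2 _).comp (measurable_pi_lambda _ fun i => ?_)
  refine Fin.lastCases ?_ (fun j => ?_) i
  · simp only [Fin.snoc_last]; fun_prop
  · simp only [Fin.snoc_castSucc]; fun_prop

/-- The target density transferred to the sphere, `π_S(z) ∝ π(x) (R² + ‖x‖²)^d` with `x` the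
stereographic projection of `z`. Only ratios of values of `π_S` are used, so the normalising
constant is left out. -/
def sphDensity {d : ℕ} (R : ℝ) (π : Euc d → ℝ) (z : Sph d) : ℝ :=
  π (stereo R z) * (R ^ 2 + ‖stereo R z‖ ^ 2) ^ d

theorem measurable_sphDensity {d : ℕ} (R : ℝ) {π : Euc d → ℝ} (hπ : Continuous π) :
    Measurable (sphDensity R π) := by
  have h := measurable_stereo (d := d) R
  exact (hπ.measurable.comp h).mul (((h.norm.pow_const 2).const_add _).pow_const d)

theorem sphDensity_pos {d : ℕ} {R : ℝ} (hR : 0 < R) {π : Euc d → ℝ} (hpos : ∀ x, 0 < π x)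
    (z : Sph d) : 0 < sphDensity R π z := by
  have := hpos (stereo R z)
  unfold sphDensity
  positivity

/-! ### The proposal of stereographic random walk Metropolis -/

/-- The projection `w - (zᵀ w) z / ‖z‖²` of `w` on the tangent space of the sphere at `z`. -/
def tangent {d : ℕ} (z : Sph d) (w : Euc (d + 1)) : Euc (d + 1) :=
  w - (inner ℝ z.1 w / ‖z.1‖ ^ 2) • z.1

theorem add_tangent_ne_zero {d : ℕ} (z : Sph d) (w : Euc (d + 1)) : z.1 + tangent z w ≠ 0 := by
  intro h
  have hz : ‖z.1‖ = 1 := by simp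
  have h1 : inner ℝ z.1 (z.1 + tangent z w) = 1 := by
    simp [tangent, inner_add_right, inner_sub_right, inner_smul_right]
  rw [h, inner_zero_right] at h1
  exact zero_ne_one h1

/-- The proposed point `(z + dz) / ‖z + dz‖`, where `dz` is the tangential part of the noise. -/
def propose {d : ℕ} (z : Sph d) (w : Euc (d + 1)) : Sph d :=
  ⟨(‖z.1 + tangent z w‖)⁻¹ • (z.1 + tangent z w), by
    have := norm_ne_zero_iff.mpr (add_tangent_ne_zero z w)
    rw [mem_sphere_zero_iff_norm, norm_smul, norm_inv, norm_norm, inv_mul_cancel₀ this]⟩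

theorem measurable_propose {d : ℕ} :
    Measurable fun p : Sph d × Euc (d + 1) => propose p.1 p.2 := by
  refine Measurable.subtype_mk ?_
  unfold tangent
  fun_prop

/-- The centred Gaussian distribution `𝒩(0, h² I)` on `ℝ^n`. -/
def gaussianNoise (n : ℕ) (h : ℝ) : Measure (Euc n) :=
  (stdGaussian (Euc n)).map fun w => h • w

instance isProbabilityMeasure_gaussianNoise (n : ℕ) (h : ℝ) :
    IsProbabilityMeasure (gaussianNoise n h) :=
  Measure.isProbabilityMeasure_map (by fun_prop)

theorem measurable_section {α β γ : Type*} [MeasurableSpace α] [MeasurableSpace β]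
    [MeasurableSpace γ] {f : α → β → γ} (hf : Measurable fun p : α × β => f p.1 p.2) (a : α) :
    Measurable (f a) :=
  hf.comp measurable_prodMk_left

theorem measurable_map_of_prod {α β γ : Type*} [MeasurableSpace α] [MeasurableSpace β]
    [MeasurableSpace γ] {f : α → β → γ} (hf : Measurable fun p : α × β => f p.1 p.2)
    (μ : Measure β) [SFinite μ] : Measurable fun a => μ.map (f a) := by
  refine Measure.measurable_of_measurable_coe _ fun s hs => ?_
  have heq : (fun a => μ.map (f a) s) =
      fun a => μ (Prod.mk a ⁻¹' ((fun p : α × β => f p.1 p.2) ⁻¹' s)) :=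
    funext fun a => Measure.map_apply (hf.comp measurable_prodMk_left) hs
  rw [heq]
  exact measurable_measure_prodMk_left (hf hs)

theorem measurable_propose_right {d : ℕ} (z : Sph d) : Measurable (propose z) :=
  measurable_section measurable_propose z

/-- The proposal kernel `Q_S(z, ·)` on the sphere: the law of `propose z w` for
`w ∼ 𝒩(0, h² I_{d+1})`. -/
def proposalKernel (d : ℕ) (h : ℝ) : Kernel (Sph d) (Sph d) where
  toFun z := (gaussianNoise (d + 1) h).map (propose z)
  measurable' := measurable_map_of_prod measurable_propose _

instance isMarkovKernel_proposalKernel (d : ℕ) (h : ℝ) : IsMarkovKernel (proposalKernel d h) :=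
  ⟨fun _ => Measure.isProbabilityMeasure_map
    (measurable_propose_right _).aemeasurable⟩

/-- `n` independent draws from `κ(z, ·)`. -/
def iid {α β : Type*} [MeasurableSpace α] [MeasurableSpace β] (κ : Kernel α β) [IsMarkovKernel κ]
    (n : ℕ) : Kernel α (Fin n → β) where
  toFun a := Measure.pi fun _ => κ a
  measurable' := by
    refine Measurable.measure_of_isPiSystem_of_isProbabilityMeasure generateFrom_pi.symm
      isPiSystem_pi ?_
    rintro _ ⟨s, hs, rfl⟩
    simp_rw [Measure.pi_pi]
    exact Finset.measurable_prod _ fun i _ => κ.measurable_coe (hs i (Set.mem_univ i))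

instance isMarkovKernel_iid {α β : Type*} [MeasurableSpace α] [MeasurableSpace β]
    (κ : Kernel α β) [IsMarkovKernel κ] (n : ℕ) : IsMarkovKernel (iid κ n) :=
  ⟨fun a => inferInstanceAs (IsProbabilityMeasure (Measure.pi fun _ : Fin n => κ a))⟩

/-! ### Weight functions -/

/-- A weight function `ω(z, z')` on the sphere: measurable and positive. -/
structure WeightFunction (d : ℕ) where
  toFun : Sph d → Sph d → ℝ
  measurable : Measurable (Function.uncurry toFun)
  pos : ∀ z z', 0 < toFun z z'

/-- The globally balanced weight function `ω(z, z') = π_S(z') / π_S(z)`. -/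
def globallyBalanced {d : ℕ} (R : ℝ) (hR : 0 < R) (π : Euc d → ℝ) (hcont : Continuous π)
    (hpos : ∀ x, 0 < π x) : WeightFunction d where
  toFun z z' := sphDensity R π z' / sphDensity R π z
  measurable := ((measurable_sphDensity R hcont).comp measurable_snd).div
    ((measurable_sphDensity R hcont).comp measurable_fst)
  pos z z' := div_pos (sphDensity_pos hR hpos z') (sphDensity_pos hR hpos z)

/-- The locally balanced weight function `ω(z, z') = √(π_S(z') / π_S(z))`. -/
def locallyBalanced {d : ℕ} (R : ℝ) (hR : 0 < R) (π : Euc d → ℝ) (hcont : Continuous π)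
    (hpos : ∀ x, 0 < π x) : WeightFunction d where
  toFun z z' := √(sphDensity R π z' / sphDensity R π z)
  measurable := (((measurable_sphDensity R hcont).comp measurable_snd).div
    ((measurable_sphDensity R hcont).comp measurable_fst)).sqrt
  pos z z' := Real.sqrt_pos.mpr (div_pos (sphDensity_pos hR hpos z') (sphDensity_pos hR hpos z))

/-! ### Stereographic multiple-try Metropolis -/

/-- The probability of selecting the candidate with index `j`, proportional to `ω(z, ẑ_j)`. -/
def selectProb {d N : ℕ} (ω : WeightFunction d) (z : Sph d) (c : Fin N → Sph d) (j : Fin N) : ℝ :=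
  ω.toFun z (c j) / ∑ i, ω.toFun z (c i)

theorem measurable_selectProb {d N : ℕ} (ω : WeightFunction d) (j : Fin N) :
    Measurable fun p : Sph d × (Fin N → Sph d) => selectProb ω p.1 p.2 j := by
  have h (i : Fin N) : Measurable fun p : Sph d × (Fin N → Sph d) => ω.toFun p.1 (p.2 i) :=
    ω.measurable.comp (measurable_fst.prodMk ((measurable_pi_apply i).comp measurable_snd))
  exact (h j).div (Finset.measurable_sum _ fun i _ => h i)

/-- The law of the selected index, given the current point `z` and the candidates. -/
def selectKernel {d : ℕ} (N : ℕ) (ω : WeightFunction d) :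
    Kernel (Sph d × (Fin N → Sph d)) (Fin N) where
  toFun p := ∑ j, ENNReal.ofReal (selectProb ω p.1 p.2 j) • Measure.dirac j
  measurable' := by
    refine Measure.measurable_of_measurable_coe _ fun s hs => ?_
    simp only [Measure.coe_finsetSum, Finset.sum_apply, Measure.smul_apply, smul_eq_mul]
    exact Finset.measurable_sum _ fun j _ =>
      (measurable_selectProb ω j).ennreal_ofReal.mul_const _

instance isMarkovKernel_selectKernel {d N : ℕ} [NeZero N] (ω : WeightFunction d) :
    IsMarkovKernel (selectKernel N ω) := by
  refine ⟨fun p => ⟨?_⟩⟩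
  have hs : 0 < ∑ i, ω.toFun p.1 (p.2 i) :=
    Finset.sum_pos (fun i _ => ω.pos _ _) Finset.univ_nonempty
  change (∑ j, ENNReal.ofReal (selectProb ω p.1 p.2 j) • Measure.dirac j) Set.univ = 1
  simp only [Measure.coe_finsetSum, Finset.sum_apply, Measure.smul_apply, smul_eq_mul,
    measure_univ, mul_one]
  rw [← ENNReal.ofReal_sum_of_nonneg
    fun j _ => show 0 ≤ selectProb ω p.1 p.2 j from div_nonneg (ω.pos _ _).le hs.le]
  simp only [selectProb]
  rw [← Finset.sum_div, div_self hs.ne', ENNReal.ofReal_one]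

/-- The acceptance probability `α(z, ẑ_j)`, given the current point `z`, the candidates
`c = (ẑ_1, …, ẑ_N)`, the selected index `j`, and the balancing points
`r = (z*_1, …, z*_{N-1})`. -/
def acceptProb {d N : ℕ} (R : ℝ) (π : Euc d → ℝ) (ω : WeightFunction d) (z : Sph d)
    (c : Fin N → Sph d) (j : Fin N) (r : Fin (N - 1) → Sph d) : ℝ :=
  min 1 ((sphDensity R π (c j) * ω.toFun (c j) z /
      (∑ i, ω.toFun (c j) (r i) + ω.toFun (c j) z)) /
    (sphDensity R π z * ω.toFun z (c j) / ∑ i, ω.toFun z (c i)))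

/-- The state of the algorithm before the accept / reject step: the current point `x`, the
candidates, the selected index, and the balancing points. -/
abbrev PreState (d N : ℕ) : Type :=
  Euc d × ((Fin N → Sph d) × Fin N) × (Fin (N - 1) → Sph d)

theorem measurable_eval {β : Type*} [MeasurableSpace β] (N : ℕ) :
    Measurable fun p : (Fin N → β) × Fin N => p.1 p.2 :=
  measurable_from_prod_countable_left fun j => measurable_pi_apply j

theorem measurable_acceptProb {d N : ℕ} (R : ℝ) (hR : 0 < R) {π : Euc d → ℝ}
    (hcont : Continuous π) (ω : WeightFunction d) :
    Measurable fun p : PreState d N =>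
      acceptProb R π ω (stereoInv R hR p.1) p.2.1.1 p.2.1.2 p.2.2 := by
  have hz : Measurable fun p : PreState d N => stereoInv R hR p.1 :=
    (measurable_stereoInv R hR).comp measurable_fst
  have hc (i : Fin N) : Measurable fun p : PreState d N => p.2.1.1 i :=
    (measurable_pi_apply i).comp (by fun_prop)
  have hr (i : Fin (N - 1)) : Measurable fun p : PreState d N => p.2.2 i :=
    (measurable_pi_apply i).comp (by fun_prop)
  have hj : Measurable fun p : PreState d N => p.2.1.1 p.2.1.2 :=
    (measurable_eval N).comp (by fun_prop)
  have hω {f g : PreState d N → Sph d} (hf : Measurable f) (hg : Measurable g) :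
      Measurable fun p => ω.toFun (f p) (g p) := ω.measurable.comp (hf.prodMk hg)
  have hπ := measurable_sphDensity R hcont
  refine measurable_const.min (Measurable.div (Measurable.div ?_ ?_) (Measurable.div ?_ ?_))
  · exact (hπ.comp hj).mul (hω hj hz)
  · exact (Finset.measurable_sum _ fun i _ => hω hj (hr i)).add (hω hj hz)
  · exact (hπ.comp hz).mul (hω hz hj)
  · exact Finset.measurable_sum _ fun i _ => hω hz (hc i)

theorem acceptProb_nonneg {d N : ℕ} {R : ℝ} (hR : 0 < R) {π : Euc d → ℝ} (hpos : ∀ x, 0 < π x)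
    (ω : WeightFunction d) (z : Sph d) (c : Fin N → Sph d) (j : Fin N)
    (r : Fin (N - 1) → Sph d) : 0 ≤ acceptProb R π ω z c j r := by
  have h (a b) : 0 ≤ ω.toFun a b := (ω.pos a b).le
  have hπ (a) : 0 ≤ sphDensity R π a := (sphDensity_pos hR hpos a).le
  refine le_min zero_le_one (div_nonneg (div_nonneg (mul_nonneg (hπ _) (h _ _)) ?_)
    (div_nonneg (mul_nonneg (hπ _) (h _ _)) ?_))
  · exact add_nonneg (Finset.sum_nonneg fun i _ => h _ _) (h _ _)
  · exact Finset.sum_nonneg fun i _ => h _ _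

/-- The accept / reject step: move to the projection of `ẑ_j` with probability `α`, otherwise stay
at `x`. -/
def acceptKernel {d : ℕ} (N : ℕ) (R : ℝ) (hR : 0 < R) (π : Euc d → ℝ) (hcont : Continuous π)
    (ω : WeightFunction d) : Kernel (PreState d N) (Euc d) where
  toFun p :=
    ENNReal.ofReal (acceptProb R π ω (stereoInv R hR p.1) p.2.1.1 p.2.1.2 p.2.2) •
        Measure.dirac (stereo R (p.2.1.1 p.2.1.2)) +
      ENNReal.ofReal (1 - acceptProb R π ω (stereoInv R hR p.1) p.2.1.1 p.2.1.2 p.2.2) •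
        Measure.dirac p.1
  measurable' := by
    have hα := measurable_acceptProb (N := N) R hR hcont ω
    have hj : Measurable fun p : PreState d N => stereo R (p.2.1.1 p.2.1.2) :=
      (measurable_stereo R).comp ((measurable_eval N).comp (by fun_prop))
    refine Measure.measurable_of_measurable_coe _ fun s hs => ?_
    simp only [Measure.coe_add, Pi.add_apply, Measure.smul_apply, smul_eq_mul]
    refine (hα.ennreal_ofReal.mul ?_).add ((hα.const_sub 1).ennreal_ofReal.mul ?_)
    · exact (Measure.measurable_coe hs).comp (Measure.measurable_dirac.comp hj)
    · exact (Measure.measurable_coe hs).comp (Measure.measurable_dirac.comp measurable_fst)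

theorem isMarkovKernel_acceptKernel {d N : ℕ} (R : ℝ) (hR : 0 < R) (π : Euc d → ℝ)
    (hcont : Continuous π) (hpos : ∀ x, 0 < π x) (ω : WeightFunction d) :
    IsMarkovKernel (acceptKernel N R hR π hcont ω) := by
  refine ⟨fun p => ⟨?_⟩⟩
  have h0 := acceptProb_nonneg hR hpos ω (stereoInv R hR p.1) p.2.1.1 p.2.1.2 p.2.2
  have h1 : acceptProb R π ω (stereoInv R hR p.1) p.2.1.1 p.2.1.2 p.2.2 ≤ 1 := min_le_left _ _
  simp only [acceptKernel, Kernel.coe_mk, Measure.coe_add, Pi.add_apply, Measure.smul_apply,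
    smul_eq_mul, measure_univ, mul_one]
  rw [← ENNReal.ofReal_add h0 (sub_nonneg.mpr h1), add_sub_cancel, ENNReal.ofReal_one]

/-- Given `x`, the joint law of the candidates `ẑ_1, …, ẑ_N` (independent draws from `Q_S(z, ·)`
with `z` the inverse projection of `x`) and the selected index. -/
def candidateKernel {d : ℕ} (N : ℕ) (R : ℝ) (hR : 0 < R) (h : ℝ) (ω : WeightFunction d) :
    Kernel (Euc d) ((Fin N → Sph d) × Fin N) :=
  (iid (proposalKernel d h) N ⊗ₖ selectKernel N ω).comap (stereoInv R hR)
    (measurable_stereoInv R hR)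

instance isMarkovKernel_candidateKernel {d N : ℕ} [NeZero N] (R : ℝ) (hR : 0 < R) (h : ℝ)
    (ω : WeightFunction d) : IsMarkovKernel (candidateKernel N R hR h ω) := by
  unfold candidateKernel; infer_instance

/-- Given the candidates and the selected index `j`, the law of the balancing points
`z*_1, …, z*_{N-1}`: independent draws from `Q_S(ẑ_j, ·)`. -/
def balancingKernel (d N : ℕ) (h : ℝ) :
    Kernel (Euc d × ((Fin N → Sph d) × Fin N)) (Fin (N - 1) → Sph d) :=
  (iid (proposalKernel d h) (N - 1)).comap (fun p => p.2.1 p.2.2)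
    ((measurable_eval N).comp measurable_snd)

instance isMarkovKernel_balancingKernel (d N : ℕ) (h : ℝ) :
    IsMarkovKernel (balancingKernel d N h) := by
  unfold balancingKernel; infer_instance

/-- The transition kernel on `ℝ^d` of stereographic multiple-try Metropolis with `N` candidates,
sphere radius `R`, step size `h`, target density `π` (possibly unnormalised) and weight `ω`. -/
def smtmKernel {d : ℕ} (N : ℕ) (R : ℝ) (hR : 0 < R) (h : ℝ) (π : Euc d → ℝ)
    (hcont : Continuous π) (ω : WeightFunction d) : Kernel (Euc d) (Euc d) :=
  ((candidateKernel N R hR h ω ⊗ₖ balancingKernel d N h) ⊗ₖ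
    acceptKernel N R hR π hcont ω).snd

theorem isMarkovKernel_smtmKernel {d N : ℕ} [NeZero N] (R : ℝ) (hR : 0 < R) (h : ℝ)
    (π : Euc d → ℝ) (hcont : Continuous π) (hpos : ∀ x, 0 < π x) (ω : WeightFunction d) :
    IsMarkovKernel (smtmKernel N R hR h π hcont ω) := by
  have := isMarkovKernel_acceptKernel (N := N) R hR π hcont hpos ω
  unfold smtmKernel; infer_instance

/-! ### The target distribution and uniform ergodicity -/

/-- The target distribution on `ℝ^d`, with density `π / ∫ π` with respect to Lebesgue measure. -/
def targetMeasure {d : ℕ} (π : Euc d → ℝ) : Measure (Euc d) :=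
  volume.withDensity fun x => ENNReal.ofReal (π x / ∫ y, π y)

/-- Total variation distance of two probability measures, `sup_A |μ(A) - ν(A)|` over all
measurable sets `A`. -/
def tvDist {α : Type*} [MeasurableSpace α] (μ ν : Measure α) : ℝ :=
  ⨆ A : {A : Set α // MeasurableSet A}, |μ.real A.1 - ν.real A.1|

/-- A Markov chain with transition kernel `P` is uniformly ergodic with limit distribution `μ` if
for every `ε > 0` there is an `n` with `‖P^n(x, ·) - μ‖_TV ≤ ε` for all `x`. (As
`P^(n+m)(x, ·)` is a mixture of the measures `P^n(y, ·)`, the bound then holds for all larger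
exponents too.) -/
def UniformlyErgodic {α : Type*} [MeasurableSpace α] (P : Kernel α α) (μ : Measure α) : Prop :=
  ∀ ε : ℝ, 0 < ε → ∃ n : ℕ, ∀ x, tvDist ((P ^ n) x) μ ≤ ε

end

end SMTM

namespace SMTM

open scoped ENNReal

/-! ### Doeblin's theorem -/

/-! The proof is Doeblin's argument on the sphere: some power of the kernel dominates a fixed
positive multiple of its invariant law, uniformly in the starting point.

Write `π_S` for the density on the sphere and `q` for the proposal density. Selecting `y` with other
candidates `c` and accepting it with balancing points `r` has weight `min (w(z,y;c)) (π_S(y)/π_S(z)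
* w(y,z;r))`, where `w` is the selection probability (`mtmWeight_mul_mtmAccept`). Multiplied by
`π_S(z)` this is invariant under exchanging `(z,c)` with `(y,r)`. As `q` is symmetric, detailed
balance follows (`isReversible_smtmKernel`).

If `π_S ≤ M`, both terms of the minimum are at least `π_S(y)/(N*M)` for either balanced weight.
Summing over the `N` candidates, one step from `z` has density at least `q(z,y) π_S(y)/M` on the
sphere. The factor `π_S(y)` turns surface measure into the target law, up to a constant, so relative
to the target the lower bound is a multiple of `q` alone (`exists_withDensity_le_smtmKernel`). Thus
no uniform positive lower bound on `π_S` is needed, although it may tend to zero at the north pole.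

The proposal is a Gaussian on the tangent space followed by central projection, so `q` depends on
the inner product only. It vanishes on the opposite hemisphere, but is bounded below on angles up to
60°. Any two points are joined by four arcs of at most 45°; the remaining slack lets each of the
three intermediate points range over a small ball, whose target mass is bounded below by
compactness. Hence four steps dominate a multiple of the target. For `d = 0` the state space is a
single point. -/

theorem isMarkovKernel_pow {α : Type*} [MeasurableSpace α] (κ : Kernel α α) [IsMarkovKernel κ]
    (n : ℕ) : IsMarkovKernel (κ ^ n) := by
  induction n with
  | zero => exact inferInstanceAs (IsMarkovKernel (Kernel.id : Kernel α α))
  | succ n ih => rw [pow_succ]; exact inferInstanceAs (IsMarkovKernel ((κ ^ n) ∘ₖ κ))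

theorem invariant_pow {α : Type*} [MeasurableSpace α] {κ : Kernel α α} {μ : Measure α}
    (hκ : Kernel.Invariant κ μ) (n : ℕ) : Kernel.Invariant (κ ^ n) μ := by
  induction n with
  | zero => exact Measure.bind_dirac
  | succ n ih => rw [pow_succ]; exact Kernel.Invariant.comp ih hκ

theorem lintegral_of_invariant {α : Type*} [MeasurableSpace α] {κ : Kernel α α} {μ : Measure α}
    (hκ : Kernel.Invariant κ μ) {A : Set α} (hA : MeasurableSet A) : ∫⁻ y, κ y A ∂μ = μ A := by
  rw [← Measure.bind_apply hA κ.aemeasurable, hκ.def]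

/-- By induction, `c` is a lower bound for `(κ ^ n) y A` uniform in `y`. Only the excess over `c` is
compared with `μ`: by invariance its `μ`-integral is `(1 - δ) ^ n * μ A`, and one more step keeps at
least the fraction `δ` of it. No residual kernel is needed. -/
theorem pow_ge_of_minorization {α : Type*} [MeasurableSpace α] {κ : Kernel α α}
    [IsMarkovKernel κ] {μ : Measure α} [IsProbabilityMeasure μ] (hinv : Kernel.Invariant κ μ)
    {δ : ℝ} (hδ0 : 0 ≤ δ) (hδ1 : δ ≤ 1) (hmin : ∀ x, ENNReal.ofReal δ • μ ≤ κ x) (n : ℕ) (x : α)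
    {A : Set α} (hA : MeasurableSet A) :
    ENNReal.ofReal ((1 - (1 - δ) ^ n) * μ.real A) ≤ (κ ^ n) x A := by
  induction n generalizing x with
  | zero => simp
  | succ n ih =>
    have := isMarkovKernel_pow κ n
    set c := ENNReal.ofReal ((1 - (1 - δ) ^ n) * μ.real A) with hc
    have hm : Measurable fun y => (κ ^ n) y A := (κ ^ n).measurable_coe hA
    have split (ν : Measure α) [IsProbabilityMeasure ν] :
        ∫⁻ y, (κ ^ n) y A ∂ν = c + ∫⁻ y, ((κ ^ n) y A - c) ∂ν := by
      calc ∫⁻ y, (κ ^ n) y A ∂ν = ∫⁻ y, (c + ((κ ^ n) y A - c)) ∂ν :=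
            lintegral_congr fun y => (add_tsub_cancel_of_le (ih y)).symm
        _ = _ := by rw [lintegral_add_left measurable_const]; simp
    have h1 : (κ ^ (n + 1)) x A = ∫⁻ y, (κ ^ n) y A ∂(κ x) := by
      simpa [add_comm] using Kernel.pow_add_apply_eq_lintegral κ 1 n x hA
    have h2 := split μ
    rw [lintegral_of_invariant (invariant_pow hinv n) hA] at h2
    set I := ∫⁻ y, ((κ ^ n) y A - c) ∂μ
    have hI : I ≠ ∞ := fun h => measure_ne_top μ A (by rw [h2, h, add_top])
    have h2' : μ.real A = (1 - (1 - δ) ^ n) * μ.real A + I.toReal := by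
      have ha : 0 ≤ (1 - (1 - δ) ^ n) * μ.real A :=
        mul_nonneg (sub_nonneg.2 (pow_le_one₀ (by linarith) (by linarith))) measureReal_nonneg
      rw [← ENNReal.toReal_ofReal ha, ← hc, ← ENNReal.toReal_add ENNReal.ofReal_ne_top hI, ← h2]
      rfl
    have h3 : ENNReal.ofReal δ * I ≤ ∫⁻ y, ((κ ^ n) y A - c) ∂(κ x) := by
      rw [← smul_eq_mul, ← lintegral_smul_measure]
      exact lintegral_mono' (hmin x) le_rfl
    rw [h1, split (κ x)]
    refine le_trans ?_ (add_le_add le_rfl h3)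
    rw [← ENNReal.ofReal_toReal hI, ← ENNReal.ofReal_mul hδ0, hc]
    refine le_trans (ENNReal.ofReal_le_ofReal ?_) ENNReal.ofReal_add_le
    have : I.toReal = (1 - δ) ^ n * μ.real A := by linarith
    rw [this, pow_succ]
    apply le_of_eq
    ring

/-- A one-sided bound suffices, because applied to `Aᶜ` it gives the upper bound on `μ A`. -/
theorem tvDist_le_of_forall_le {α : Type*} [MeasurableSpace α] {μ ν : Measure α}
    [IsProbabilityMeasure μ] [IsProbabilityMeasure ν] {a : ℝ} (ha : 0 ≤ a)
    (h : ∀ A, MeasurableSet A → (1 - a) * ν.real A ≤ μ.real A) : tvDist μ ν ≤ a := by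
  have : Nonempty {A : Set α // MeasurableSet A} := ⟨⟨∅, MeasurableSet.empty⟩⟩
  refine ciSup_le fun ⟨A, hA⟩ => ?_
  have h1 := h A hA
  have h2 := h Aᶜ hA.compl
  rw [probReal_compl_eq_one_sub hA, probReal_compl_eq_one_sub hA] at h2
  have h3 : ν.real A ≤ 1 := measureReal_le_one
  have h4 : 0 ≤ ν.real A := measureReal_nonneg
  rw [abs_le]
  constructor <;> nlinarith

/-- A Markov kernel one of whose powers is minorized by a positive multiple of an invariant
distribution is uniformly ergodic. -/
theorem uniformlyErgodic_of_minorization {α : Type*} [MeasurableSpace α] {κ : Kernel α α}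
    [IsMarkovKernel κ] {μ : Measure α} [IsProbabilityMeasure μ] (hinv : Kernel.Invariant κ μ)
    {k : ℕ} {c : ℝ≥0∞} (hc : c ≠ 0) (hmin : ∀ x, c • μ ≤ (κ ^ k) x) : UniformlyErgodic κ μ := by
  intro ε hε
  -- Capping at 1 gives a real `δ` in `(0, 1]` without first showing that `c ≤ 1`.
  set δ : ℝ := (min c 1).toReal with hδ
  have hfin : min c 1 ≠ ∞ := ne_top_of_le_ne_top ENNReal.one_ne_top (min_le_right _ _)
  have hδ0 : 0 < δ := ENNReal.toReal_pos (by simp [hc]) hfin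
  have hδ1 : δ ≤ 1 := by
    simpa using (ENNReal.toReal_le_toReal hfin ENNReal.one_ne_top).2 (min_le_right c 1)
  have hmin' (x) : ENNReal.ofReal δ • μ ≤ (κ ^ k) x := by
    refine le_trans ?_ (hmin x)
    rw [hδ, ENNReal.ofReal_toReal hfin]
    exact fun s => mul_le_mul_left (min_le_left _ _) _
  have := isMarkovKernel_pow κ k
  obtain ⟨n, hn⟩ := exists_pow_lt_of_lt_one hε (show 1 - δ < 1 by linarith)
  refine ⟨k * n, fun x => le_trans ?_ hn.le⟩
  have := isMarkovKernel_pow κ (k * n)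
  refine tvDist_le_of_forall_le (pow_nonneg (by linarith) _) fun A hA => ?_
  have h := pow_ge_of_minorization (invariant_pow hinv k) hδ0.le hδ1 hmin' n x hA
  rw [← pow_mul] at h
  exact (ENNReal.ofReal_le_iff_le_toReal (measure_ne_top _ _)).1 h

/-- Two kernels with lower bounds for their densities with respect to `μ` compose to a kernel with
the composed lower bound. -/
theorem withDensity_le_pow_succ {α : Type*} [MeasurableSpace α] {κ : Kernel α α}
    {μ : Measure α} [SFinite μ] {p q : α → α → ℝ≥0∞} (hp : Measurable (Function.uncurry p))
    (hq : Measurable (Function.uncurry q)) {n : ℕ} (h1 : ∀ x, μ.withDensity (p x) ≤ κ x)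
    (hn : ∀ x, μ.withDensity (q x) ≤ (κ ^ n) x) (x : α) :
    μ.withDensity (fun y => ∫⁻ w, q x w * p w y ∂μ) ≤ (κ ^ (n + 1)) x := by
  refine Measure.le_iff.2 fun A hA => ?_
  rw [Kernel.pow_succ_apply_eq_lintegral _ _ _ hA, withDensity_apply _ hA]
  have hqx : Measurable (q x) := hq.comp measurable_prodMk_left
  calc ∫⁻ y in A, ∫⁻ w, q x w * p w y ∂μ ∂μ = ∫⁻ w, ∫⁻ y in A, q x w * p w y ∂μ ∂μ := by
        refine lintegral_lintegral_swap (Measurable.aemeasurable ?_)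
        exact (hqx.comp measurable_snd).mul (hp.comp measurable_swap)
    _ = ∫⁻ w, q x w * ∫⁻ y in A, p w y ∂μ ∂μ := by
        refine lintegral_congr fun w => lintegral_const_mul _ (hp.comp measurable_prodMk_left)
    _ ≤ ∫⁻ w, q x w * κ w A ∂μ := by
        gcongr with w
        rw [← withDensity_apply _ hA]
        exact h1 w A
    _ = ∫⁻ w, κ w A ∂(μ.withDensity (q x)) := by
        rw [lintegral_withDensity_eq_lintegral_mul _ hqx (κ.measurable_coe hA)]; rfl
    _ ≤ _ := lintegral_mono' (hn x) le_rfl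

/-! ### Integration on `ℝ^(d+1)` and on the sphere -/

/-- The point `(y, t)` of `ℝ^(d+1)`. -/
noncomputable def snocE {d : ℕ} (y : Euc d) (t : ℝ) : Euc (d + 1) :=
  WithLp.toLp 2 (Fin.snoc (α := fun _ => ℝ) (fun i => y i) t)

@[simp] theorem snocE_castSucc {d : ℕ} (y : Euc d) (t : ℝ) (i : Fin d) :
    snocE y t i.castSucc = y i := by simp [snocE]

@[simp] theorem snocE_last {d : ℕ} (y : Euc d) (t : ℝ) : snocE y t (Fin.last d) = t := by
  simp [snocE]

theorem ext_snocE {d : ℕ} {u v : Euc (d + 1)} (h : ∀ i : Fin d, u i.castSucc = v i.castSucc)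
    (hl : u (Fin.last d) = v (Fin.last d)) : u = v :=
  PiLp.ext fun i => Fin.lastCases hl h i

theorem smul_snocE {d : ℕ} (c : ℝ) (y : Euc d) (t : ℝ) : c • snocE y t = snocE (c • y) (c * t) :=
  ext_snocE (by simp) (by simp)

theorem norm_snocE_sq {d : ℕ} (y : Euc d) (t : ℝ) : ‖snocE y t‖ ^ 2 = ‖y‖ ^ 2 + t ^ 2 := by
  rw [EuclideanSpace.real_norm_sq_eq, EuclideanSpace.real_norm_sq_eq, Fin.sum_univ_castSucc]
  simp

theorem measurable_snocE {d : ℕ} : Measurable fun p : Euc d × ℝ => snocE p.1 p.2 := by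
  refine (WithLp.measurable_toLp 2 _).comp (measurable_pi_lambda _ fun i => ?_)
  refine Fin.lastCases ?_ (fun j => ?_) i
  · simp only [Fin.snoc_last]; fun_prop
  · simp only [Fin.snoc_castSucc]; fun_prop

@[fun_prop]
theorem _root_.Measurable.snocE {α : Type*} [MeasurableSpace α] {d : ℕ} {f : α → Euc d}
    {g : α → ℝ} (hf : Measurable f) (hg : Measurable g) : Measurable fun a => snocE (f a) (g a) :=
  measurable_snocE.comp (hf.prodMk hg)

theorem measurePreserving_snoc {d : ℕ} (μ : Measure ℝ) [SigmaFinite μ] :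
    MeasurePreserving (fun p : ℝ × (Fin d → ℝ) => Fin.snoc (α := fun _ => ℝ) p.2 p.1)
      (μ.prod (Measure.pi fun _ : Fin d => μ)) (Measure.pi fun _ : Fin (d + 1) => μ) := by
  have h := (measurePreserving_piFinSuccAbove (fun _ : Fin (d + 1) => μ) (Fin.last d)).symm
  convert h using 1
  ext p
  simp [MeasurableEquiv.piFinSuccAbove]

theorem lintegral_snocE {d : ℕ} {F : Euc (d + 1) → ℝ≥0∞} (hF : Measurable F) :
    ∫⁻ u, F u = ∫⁻ t : ℝ, ∫⁻ y : Euc d, F (snocE y t) := by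
  have hT (n : ℕ) := (PiLp.volume_preserving_toLp (Fin n))
  have h1 : Measurable fun x : Fin (d + 1) → ℝ => F (WithLp.toLp 2 x) :=
    hF.comp (WithLp.measurable_toLp 2 _)
  rw [← (hT (d + 1)).lintegral_comp hF, volume_pi,
    ← (measurePreserving_snoc (d := d) volume).lintegral_comp h1, lintegral_prod]
  · refine lintegral_congr fun t => ?_
    rw [← (hT d).lintegral_comp]
    · rfl
    · exact hF.comp (measurable_snocE.comp (measurable_id.prodMk measurable_const))
  · exact (h1.comp (measurePreserving_snoc volume).measurable).aemeasurable

theorem lintegral_comp_smul_Euc {d : ℕ} {F : Euc d → ℝ≥0∞} (hF : Measurable F) {r : ℝ}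
    (hr : 0 < r) : ∫⁻ y, F y = ENNReal.ofReal (r ^ d) * ∫⁻ y, F (r • y) := by
  rw [← lintegral_map hF (measurable_const_smul r), Measure.map_addHaar_smul _ hr.ne',
    lintegral_smul_measure, smul_eq_mul, ← mul_assoc, ← ENNReal.ofReal_mul (by positivity)]
  simp [abs_of_pos hr, hr.ne']

/-! ### Radial projection, the cone measure and coordinates on the sphere -/

/-- Radial projection `u ↦ u / ‖u‖` to the sphere; the origin is sent to the north pole. -/
noncomputable def nrm {d : ℕ} (u : Euc (d + 1)) : Sph d :=
  ⟨if u = 0 then snocE 0 1 else ‖u‖⁻¹ • u, by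
    rw [mem_sphere_zero_iff_norm]
    split_ifs with h
    · have := norm_snocE_sq (0 : Euc d) 1
      simp only [norm_zero] at this
      nlinarith [norm_nonneg (snocE (0 : Euc d) 1)]
    · rw [norm_smul, norm_inv, norm_norm, inv_mul_cancel₀ (norm_ne_zero_iff.2 h)]⟩

theorem nrm_coe {d : ℕ} {u : Euc (d + 1)} (h : u ≠ 0) : (nrm u).1 = ‖u‖⁻¹ • u := by
  simp [nrm, h]

theorem nrm_smul {d : ℕ} {c : ℝ} (hc : 0 < c) (u : Euc (d + 1)) : nrm (c • u) = nrm u := by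
  by_cases h : u = 0
  · simp [h]
  · refine Subtype.ext ?_
    rw [nrm_coe h, nrm_coe (smul_ne_zero hc.ne' h), norm_smul, smul_smul, Real.norm_of_nonneg hc.le,
      mul_inv, mul_comm c⁻¹, mul_assoc, inv_mul_cancel₀ hc.ne', mul_one]

theorem nrm_of_mem {d : ℕ} (z : Sph d) : nrm z.1 = z := by
  have hz : ‖z.1‖ = 1 := by simp
  refine Subtype.ext ?_
  rw [nrm_coe (norm_ne_zero_iff.1 (by simp)), hz, inv_one, one_smul]

theorem measurable_nrm {d : ℕ} : Measurable (nrm (d := d)) := by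
  refine Measurable.subtype_mk (Measurable.ite (measurableSet_singleton 0) measurable_const ?_)
  fun_prop

/-- A multiple of the surface measure of the sphere: the cone measure. -/
noncomputable def surf (d : ℕ) : Measure (Sph d) :=
  (volume.restrict (Metric.ball (0 : Euc (d + 1)) 1)).map nrm

theorem lintegral_surf {d : ℕ} {G : Sph d → ℝ≥0∞} (hG : Measurable G) :
    ∫⁻ z, G z ∂(surf d) =
      ∫⁻ u : Euc (d + 1), (if ‖u‖ < 1 then 1 else 0) * G (nrm u) := by
  rw [surf, lintegral_map hG measurable_nrm, ← lintegral_indicator measurableSet_ball]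
  refine lintegral_congr fun u => ?_
  by_cases h : ‖u‖ < 1 <;> simp [Set.indicator, h]

instance isFiniteMeasure_surf (d : ℕ) : IsFiniteMeasure (surf d) := by
  have : IsFiniteMeasure (volume.restrict (Metric.ball (0 : Euc (d + 1)) 1)) :=
    ⟨by simpa using measure_ball_lt_top⟩
  exact Measure.isFiniteMeasure_map _ _

/-- The integral along a ray of direction `v`, with `m = ‖v‖`: the unit ball cuts it at `t = 1 / m`.
Both coordinate formulas for `surf` end with it. -/
theorem lintegral_radial (d : ℕ) {m : ℝ} (hm : 0 < m) :
    ∫⁻ t in Set.Ioi (0 : ℝ), ENNReal.ofReal (t ^ d) * (if t * m < 1 then 1 else 0) =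
      ENNReal.ofReal ((m ^ (d + 1))⁻¹ / (d + 1)) := by
  have h1 : ∀ t : ℝ, ENNReal.ofReal (t ^ d) * (if t * m < 1 then 1 else 0) =
      (Set.Iio m⁻¹).indicator (fun t => ENNReal.ofReal (t ^ d)) t := by
    intro t
    have : t * m < 1 ↔ t < m⁻¹ := by rw [← one_div, lt_div_iff₀ hm]
    by_cases h : t < m⁻¹ <;> simp [Set.indicator, this, h]
  simp_rw [h1]
  rw [lintegral_indicator measurableSet_Iio, Measure.restrict_restrict measurableSet_Iio,
    Set.inter_comm, Set.Ioi_inter_Iio, restrict_Ioo_eq_restrict_Ioc]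
  rw [← ofReal_integral_eq_lintegral_ofReal]
  · rw [← intervalIntegral.integral_of_le (by positivity), integral_pow]
    simp
  · exact (intervalIntegral.intervalIntegrable_pow d).1
  · exact (ae_restrict_iff' measurableSet_Ioc).2 (.of_forall fun t ht => pow_nonneg ht.1.le _)

theorem measurable_ball_weight {d : ℕ} {G : Sph d → ℝ≥0∞} (hG : Measurable G) :
    Measurable fun u : Euc (d + 1) => (if ‖u‖ < 1 then 1 else 0) * G (nrm u) :=
  (Measurable.ite (measurableSet_lt measurable_norm measurable_const) measurable_const
    measurable_const).mul (hG.comp measurable_nrm)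

theorem snocE_one_ne_zero {d : ℕ} (v : Euc d) : snocE v 1 ≠ 0 := fun h => by
  simpa using congrArg (fun u : Euc (d + 1) => u (Fin.last d)) h

theorem nrm_last {d : ℕ} (u : Euc (d + 1)) (hu : u ≠ 0) :
    (nrm u).1 (Fin.last d) = ‖u‖⁻¹ * u (Fin.last d) := by
  rw [nrm_coe hu]; rfl

/-- Integration over the upper hemisphere in gnomonic coordinates. -/
theorem lintegral_surf_gnomonic {d : ℕ} {G : Sph d → ℝ≥0∞} (hG : Measurable G)
    (hG0 : ∀ z : Sph d, z.1 (Fin.last d) ≤ 0 → G z = 0) :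
    ∫⁻ z, G z ∂(surf d) = ∫⁻ v : Euc d,
      G (nrm (snocE v 1)) * ENNReal.ofReal ((‖snocE v 1‖ ^ (d + 1))⁻¹ / (d + 1)) := by
  have hm := measurable_ball_weight hG
  have hGm : Measurable fun v : Euc d => G (nrm (snocE v 1)) :=
    hG.comp (measurable_nrm.comp (measurable_snocE.comp (measurable_id.prodMk measurable_const)))
  have hn : Measurable fun v : Euc d => ‖snocE v 1‖ :=
    (measurable_snocE.comp (measurable_id.prodMk measurable_const)).norm
  rw [lintegral_surf hG, lintegral_snocE hm]
  calc _ = ∫⁻ t in Set.Ioi (0 : ℝ), ∫⁻ y : Euc d,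
        (if ‖snocE y t‖ < 1 then 1 else 0) * G (nrm (snocE y t)) := by
        rw [← lintegral_indicator measurableSet_Ioi]
        refine lintegral_congr_ae ?_
        have h0 : ∀ᵐ t : ℝ, t ≠ 0 := by simp [ae_iff]
        filter_upwards [h0] with t ht0
        rcases lt_or_gt_of_ne ht0 with ht | ht
        · rw [Set.indicator_of_notMem (by simpa using ht.le)]
          refine lintegral_eq_zero_of_ae_eq_zero (.of_forall fun y => ?_)
          have hne : snocE y t ≠ 0 := fun h => by
            have := congrArg (fun u : Euc (d + 1) => u (Fin.last d)) h
            simp at this; exact ht0 this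
          have : (nrm (snocE y t)).1 (Fin.last d) ≤ 0 := by
            rw [nrm_last _ hne, snocE_last]
            exact mul_nonpos_of_nonneg_of_nonpos (by positivity) ht.le
          simp [hG0 _ this]
        · rw [Set.indicator_of_mem (by simpa using ht)]
    -- Substituting `y = t • v` puts the point on the ray through `(v, 1)`, whose radial projection
    -- does not depend on `t`.
    _ = ∫⁻ t in Set.Ioi (0 : ℝ), ∫⁻ v : Euc d, G (nrm (snocE v 1)) *
          (ENNReal.ofReal (t ^ d) * (if t * ‖snocE v 1‖ < 1 then 1 else 0)) := by
        refine setLIntegral_congr_fun measurableSet_Ioi fun t (ht : 0 < t) => ?_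
        have hmt : Measurable fun y : Euc d =>
            (if ‖snocE y t‖ < 1 then 1 else 0) * G (nrm (snocE y t)) :=
          hm.comp (measurable_id.snocE measurable_const)
        rw [lintegral_comp_smul_Euc hmt ht, ← lintegral_const_mul]
        · refine lintegral_congr fun v => ?_
          have : snocE (t • v) t = t • snocE v 1 := by rw [smul_snocE, mul_one]
          rw [this, nrm_smul ht, norm_smul, Real.norm_of_nonneg ht.le]
          ring
        · exact hmt.comp (measurable_const_smul t)
    _ = ∫⁻ v : Euc d, ∫⁻ t in Set.Ioi (0 : ℝ), G (nrm (snocE v 1)) *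
          (ENNReal.ofReal (t ^ d) * (if t * ‖snocE v 1‖ < 1 then 1 else 0)) := by
        refine lintegral_lintegral_swap (Measurable.aemeasurable ?_)
        refine (hGm.comp measurable_snd).mul (Measurable.mul (by fun_prop) ?_)
        exact Measurable.ite (measurableSet_lt (measurable_fst.mul (hn.comp measurable_snd))
          measurable_const) measurable_const measurable_const
    _ = _ := by
        refine lintegral_congr fun v => ?_
        rw [lintegral_const_mul, lintegral_radial d (norm_pos_iff.2 (snocE_one_ne_zero v))]
        refine Measurable.mul (by fun_prop) ?_
        exact Measurable.ite (measurableSet_lt (measurable_id.mul_const _)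
          measurable_const) measurable_const measurable_const

theorem stereoInvVec_eq {d : ℕ} (R : ℝ) (x : Euc d) :
    stereoInvVec R x =
      snocE ((2 * R / (‖x‖ ^ 2 + R ^ 2)) • x) ((‖x‖ ^ 2 - R ^ 2) / (‖x‖ ^ 2 + R ^ 2)) :=
  ext_snocE (fun i => by simp [stereoInvVec]; ring) (by simp [stereoInvVec])

/-- For positive `a` and `b`, `τ ↦ b / τ - a * τ` is a decreasing bijection from `(0, ∞)` to `ℝ`.
This is the only nonlinear substitution needed for stereographic coordinates. -/
theorem lintegral_inversion {a b : ℝ} (ha : 0 < a) (hb : 0 < b) (F : ℝ → ℝ≥0∞) :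
    ∫⁻ s, F s = ∫⁻ τ in Set.Ioi (0 : ℝ),
      ENNReal.ofReal (b / τ ^ 2 + a) * F (b / τ - a * τ) := by
  have hder (τ : ℝ) (hτ : τ ∈ Set.Ioi (0 : ℝ)) : HasDerivWithinAt (fun τ => b / τ - a * τ)
      (-(b / τ ^ 2 + a)) (Set.Ioi 0) τ := by
    have h1 : HasDerivAt (fun τ : ℝ => b / τ - a * τ) (b * (-(τ ^ 2)⁻¹) - a * 1) τ :=
      ((hasDerivAt_inv (ne_of_gt hτ)).const_mul b).sub ((hasDerivAt_id τ).const_mul a)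
    refine (h1.congr_deriv ?_).hasDerivWithinAt
    ring
  have hanti : AntitoneOn (fun τ => b / τ - a * τ) (Set.Ioi 0) := by
    intro s (hs : 0 < s) t (ht : 0 < t) hst
    have : b / t ≤ b / s := by gcongr
    simp only
    nlinarith
  have hsurj : (fun τ => b / τ - a * τ) '' Set.Ioi 0 = Set.univ := by
    refine Set.eq_univ_of_forall fun s => ?_
    set D := √(s ^ 2 + 4 * a * b) with hD
    have hD2 : D ^ 2 = s ^ 2 + 4 * a * b := Real.sq_sqrt (by positivity)
    have hDs : s < D := by
      refine Real.lt_sqrt_of_sq_lt ?_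
      nlinarith [mul_pos ha hb]
    have h0 : 0 < D - s := sub_pos.2 hDs
    have h1 : 0 < (D - s) / (2 * a) := by positivity
    -- The positive root of `a τ² + s τ - b = 0`.
    refine ⟨(D - s) / (2 * a), h1, ?_⟩
    simp only
    field_simp
    nlinarith
  rw [← setLIntegral_univ, ← hsurj,
    lintegral_image_eq_lintegral_deriv_mul_of_antitoneOn measurableSet_Ioi hder hanti]
  simp

/-- Integration over the sphere in stereographic coordinates. -/
theorem lintegral_surf_stereographic {d : ℕ} (hd : d ≠ 0) {R : ℝ} (hR : 0 < R)
    {G : Sph d → ℝ≥0∞} (hG : Measurable G) :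
    ∫⁻ z, G z ∂(surf d) = ENNReal.ofReal ((2 * R) ^ d / (d + 1)) *
      ∫⁻ x : Euc d, G (stereoInv R hR x) * ENNReal.ofReal (((‖x‖ ^ 2 + R ^ 2) ^ d)⁻¹) := by
  have hm := measurable_ball_weight hG
  set H : Euc (d + 1) → ℝ≥0∞ := fun u => (if ‖u‖ < 1 then 1 else 0) * G (nrm u) with hH
  have hGm : Measurable fun x : Euc d => G (stereoInv R hR x) := hG.comp (measurable_stereoInv R hR)
  have : Nontrivial (Euc d) := by
    have : NeZero d := ⟨hd⟩
    infer_instance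
  have hpos (x : Euc d) : 0 < ‖x‖ ^ 2 + R ^ 2 := by positivity
  rw [lintegral_surf hG, lintegral_snocE hm]
  calc _ = ∫⁻ y : Euc d, ∫⁻ t : ℝ, H (snocE y t) :=
        lintegral_lintegral_swap (hm.comp (measurable_snocE.comp measurable_swap)).aemeasurable
    -- The last coordinate is replaced by `τ` with `t = ‖y‖² / (4 R² τ) - R² τ`. After scaling `y =
    -- 2 R τ x`, the point `(y, t)` becomes `τ (‖x‖² + R²)` times the inverse projection of `x`.
    -- Thus `τ` parametrizes the ray, and no Jacobian determinant of the stereographic map has to be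
    -- computed.
    _ = ∫⁻ y : Euc d, ∫⁻ τ in Set.Ioi (0 : ℝ),
          ENNReal.ofReal (‖y‖ ^ 2 / (4 * R ^ 2) / τ ^ 2 + R ^ 2) *
            H (snocE y (‖y‖ ^ 2 / (4 * R ^ 2) / τ - R ^ 2 * τ)) := by
        refine lintegral_congr_ae ?_
        -- The substitution degenerates at `y = 0`, a null set only because `d ≠ 0`.
        have h0 : ∀ᵐ y : Euc d, y ≠ 0 := by simp [ae_iff]
        filter_upwards [h0] with y hy
        have := norm_pos_iff.2 hy
        exact lintegral_inversion (by positivity) (by positivity) _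
    _ = ∫⁻ τ in Set.Ioi (0 : ℝ), ∫⁻ y : Euc d,
          ENNReal.ofReal (‖y‖ ^ 2 / (4 * R ^ 2) / τ ^ 2 + R ^ 2) *
            H (snocE y (‖y‖ ^ 2 / (4 * R ^ 2) / τ - R ^ 2 * τ)) := by
        refine lintegral_lintegral_swap (Measurable.aemeasurable ?_)
        refine Measurable.mul (by fun_prop) (hm.comp (Measurable.snocE ?_ ?_)) <;> fun_prop
    _ = ∫⁻ τ in Set.Ioi (0 : ℝ), ∫⁻ x : Euc d,
          ENNReal.ofReal ((2 * R) ^ d * (‖x‖ ^ 2 + R ^ 2)) * G (stereoInv R hR x) *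
          (ENNReal.ofReal (τ ^ d) * (if τ * (‖x‖ ^ 2 + R ^ 2) < 1 then 1 else 0)) := by
        refine setLIntegral_congr_fun measurableSet_Ioi fun τ (hτ : 0 < τ) => ?_
        have h2 : 0 < 2 * R * τ := by positivity
        have hmeas : Measurable fun y : Euc d =>
            ENNReal.ofReal (‖y‖ ^ 2 / (4 * R ^ 2) / τ ^ 2 + R ^ 2) *
            H (snocE y (‖y‖ ^ 2 / (4 * R ^ 2) / τ - R ^ 2 * τ)) := by
          refine Measurable.mul (by fun_prop) (hm.comp (Measurable.snocE ?_ ?_)) <;> fun_prop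
        rw [lintegral_comp_smul_Euc hmeas h2, ← lintegral_const_mul]
        · refine lintegral_congr fun x => ?_
          have hx := hpos x
          have e1 : ‖(2 * R * τ) • x‖ ^ 2 = (2 * R * τ) ^ 2 * ‖x‖ ^ 2 := by
            rw [norm_smul, mul_pow, Real.norm_of_nonneg h2.le]
          have e2 : snocE ((2 * R * τ) • x)
              ((2 * R * τ) ^ 2 * ‖x‖ ^ 2 / (4 * R ^ 2) / τ - R ^ 2 * τ) =
              (τ * (‖x‖ ^ 2 + R ^ 2)) • stereoInvVec R x := by
            rw [stereoInvVec_eq, smul_snocE, smul_smul]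
            congr 1
            · congr 1; field_simp
            · field_simp; ring
          have e3 : (2 * R * τ) ^ 2 * ‖x‖ ^ 2 / (4 * R ^ 2) / τ ^ 2 + R ^ 2 = ‖x‖ ^ 2 + R ^ 2 := by
            field_simp; ring
          have e4 : nrm (stereoInvVec R x) = stereoInv R hR x := nrm_of_mem (stereoInv R hR x)
          rw [e1, e2, e3, hH]
          simp only
          rw [nrm_smul (by positivity), e4, norm_smul, norm_stereoInvVec hR, mul_one,
            Real.norm_of_nonneg (by positivity), mul_pow, ENNReal.ofReal_mul (by positivity),
            ENNReal.ofReal_mul (by positivity)]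
          ring
        · exact hmeas.comp (measurable_const_smul (2 * R * τ))
    _ = ∫⁻ x : Euc d, ∫⁻ τ in Set.Ioi (0 : ℝ),
          ENNReal.ofReal ((2 * R) ^ d * (‖x‖ ^ 2 + R ^ 2)) * G (stereoInv R hR x) *
          (ENNReal.ofReal (τ ^ d) * (if τ * (‖x‖ ^ 2 + R ^ 2) < 1 then 1 else 0)) := by
        refine lintegral_lintegral_swap (Measurable.aemeasurable ?_)
        refine (Measurable.mul (by fun_prop) (hGm.comp measurable_snd)).mul
          (Measurable.mul (by fun_prop) ?_)
        exact Measurable.ite (measurableSet_lt (by fun_prop)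
          measurable_const) measurable_const measurable_const
    _ = ∫⁻ x : Euc d, ENNReal.ofReal ((2 * R) ^ d / (d + 1)) *
          (G (stereoInv R hR x) * ENNReal.ofReal (((‖x‖ ^ 2 + R ^ 2) ^ d)⁻¹)) := by
        refine lintegral_congr fun x => ?_
        have hx := hpos x
        rw [lintegral_const_mul, lintegral_radial d hx, mul_right_comm,
          ← ENNReal.ofReal_mul (by positivity), mul_left_comm,
          ← ENNReal.ofReal_mul (by positivity), mul_comm]
        · congr 2
          field_simp
          ring
        · refine Measurable.mul (by fun_prop) ?_
          exact Measurable.ite (measurableSet_lt (measurable_id.mul_const _)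
            measurable_const) measurable_const measurable_const
    _ = _ := by
        rw [lintegral_const_mul]
        exact hGm.mul (by fun_prop)

/-! ### The density of the proposal -/

theorem lintegral_pi_prod {n : ℕ} (μ : Measure ℝ) [SigmaFinite μ] {f : Fin n → ℝ → ℝ≥0∞}
    (hf : ∀ i, Measurable (f i)) :
    ∫⁻ x, ∏ i, f i (x i) ∂(Measure.pi fun _ : Fin n => μ) = ∏ i, ∫⁻ t, f i t ∂μ := by
  induction n with
  | zero => simp
  | succ n ih =>
    have hm (m : ℕ) (g : Fin m → ℝ → ℝ≥0∞) (hg : ∀ i, Measurable (g i)) :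
        Measurable fun x : Fin m → ℝ => ∏ i, g i (x i) :=
      Finset.measurable_prod _ fun i _ => (hg i).comp (measurable_pi_apply i)
    rw [← (measurePreserving_snoc μ).lintegral_comp (hm _ f hf)]
    simp only [Fin.prod_univ_castSucc, Fin.snoc_castSucc, Fin.snoc_last]
    rw [lintegral_prod, ← ih fun i => hf i.castSucc, ← lintegral_const_mul _ (hf _)]
    · exact lintegral_congr fun t => lintegral_mul_const (μ := Measure.pi fun _ : Fin n => μ)
        (f (Fin.last n) t) (hm n _ fun i => hf i.castSucc)
    · exact (((hm n _ fun i => hf i.castSucc).comp measurable_snd).mul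
        ((hf _).comp measurable_fst)).aemeasurable

/-- Applied to one-dimensional Gaussians, this yields the density of the standard Gaussian on `ℝ^d`.
-/
theorem pi_withDensity {n : ℕ} {f : ℝ → ℝ≥0∞} (hf : Measurable f) (μ : Measure ℝ) [SigmaFinite μ]
    [SigmaFinite (μ.withDensity f)] :
    (Measure.pi fun _ : Fin n => μ.withDensity f) =
      (Measure.pi fun _ : Fin n => μ).withDensity fun x => ∏ i, f (x i) := by
  refine Measure.pi_eq fun s hs => ?_
  have hS : MeasurableSet (Set.univ.pi s) := MeasurableSet.univ_pi hs
  rw [withDensity_apply _ hS, ← lintegral_indicator hS]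
  have h1 (i : Fin n) : μ.withDensity f (s i) = ∫⁻ t, (s i).indicator f t ∂μ := by
    rw [withDensity_apply f (hs i), lintegral_indicator (hs i)]
  simp_rw [h1]
  rw [← lintegral_pi_prod μ fun i => hf.indicator (hs i)]
  refine lintegral_congr fun x => ?_
  by_cases hx : x ∈ Set.univ.pi s
  · rw [Set.indicator_of_mem hx]
    exact Finset.prod_congr rfl fun i _ =>
      (Set.indicator_of_mem (hx i (Set.mem_univ i)) f).symm
  · rw [Set.indicator_of_notMem hx]
    simp only [Set.mem_univ_pi, not_forall] at hx
    obtain ⟨i, hi⟩ := hx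
    exact (Finset.prod_eq_zero (Finset.mem_univ i) (Set.indicator_of_notMem hi f)).symm

/-- The density of `𝒩(0, h² I)` on `ℝ^d` as a function of the squared norm. -/
noncomputable def gaussianProfile (d : ℕ) (h s : ℝ) : ℝ :=
  ((√(2 * Real.pi) * h) ^ d)⁻¹ * Real.exp (-s / (2 * h ^ 2))

theorem gaussianProfile_pos {d : ℕ} {h : ℝ} (hh : 0 < h) (s : ℝ) : 0 < gaussianProfile d h s := by
  unfold gaussianProfile; positivity

theorem lintegral_stdGaussian {d : ℕ} {F : Euc d → ℝ≥0∞} (hF : Measurable F) :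
    ∫⁻ w, F w ∂(stdGaussian (Euc d)) =
      ∫⁻ v, ENNReal.ofReal (gaussianProfile d 1 (‖v‖ ^ 2)) * F v := by
  have hT := WithLp.measurable_toLp 2 (Fin d → ℝ)
  have : SigmaFinite (volume.withDensity (gaussianPDF 0 1)) := by
    rw [← gaussianReal_of_var_ne_zero 0 one_ne_zero]; infer_instance
  have hFT : Measurable fun x : Fin d → ℝ => F (WithLp.toLp 2 x) := hF.comp hT
  rw [← map_pi_eq_stdGaussian, lintegral_map hF hT, gaussianReal_of_var_ne_zero 0 one_ne_zero,
    pi_withDensity (measurable_gaussianPDF 0 1), lintegral_withDensity_eq_lintegral_mul _ _ hFT,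
    ← (PiLp.volume_preserving_toLp (Fin d)).lintegral_comp, volume_pi]
  · refine lintegral_congr fun x => ?_
    simp only [Pi.mul_apply]
    congr 1
    simp only [gaussianPDF]
    rw [← ENNReal.ofReal_prod_of_nonneg fun i _ => gaussianPDFReal_nonneg _ _ _]
    congr 1
    simp only [gaussianPDFReal, gaussianProfile, EuclideanSpace.real_norm_sq_eq,
      Finset.prod_mul_distrib, ← Real.exp_sum]
    simp [Finset.sum_div, neg_div]
    rw [← mul_inv_rev, inv_pow]
  · unfold gaussianProfile
    fun_prop
  · exact Finset.measurable_prod _ fun i _ =>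
      (measurable_gaussianPDF 0 1).comp (measurable_pi_apply i)

/-- The projection of `ℝ^(d+1)` on the first `d` coordinates. -/
noncomputable def initE {d : ℕ} (u : Euc (d + 1)) : Euc d := WithLp.toLp 2 fun i => u i.castSucc

theorem measurable_initE {d : ℕ} : Measurable (initE (d := d)) := by
  unfold initE
  fun_prop

theorem map_initE_stdGaussian (d : ℕ) :
    (stdGaussian (Euc (d + 1))).map initE = stdGaussian (Euc d) := by
  have hT (n : ℕ) := WithLp.measurable_toLp 2 (Fin n → ℝ)
  have hs := measurePreserving_snoc (d := d) (gaussianReal 0 1)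
  rw [← map_pi_eq_stdGaussian, ← map_pi_eq_stdGaussian, ← hs.map_eq,
    Measure.map_map measurable_initE (hT _), Measure.map_map (measurable_initE.comp (hT _))
      hs.measurable]
  have : (initE ∘ WithLp.toLp 2) ∘ (fun p : ℝ × (Fin d → ℝ) => Fin.snoc (α := fun _ => ℝ) p.2 p.1)
      = WithLp.toLp 2 ∘ Prod.snd := by
    ext p i
    simp [initE]
  rw [this, ← Measure.map_map (hT d) measurable_snd]
  congr 1
  exact Measure.map_snd_prod.trans (by simp)

/-- At the north pole the tangential part of the noise consists of its first `d` coordinates, which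
again form a centred Gaussian with variance `h²` in each coordinate. -/
theorem lintegral_gaussianNoise_initE {d : ℕ} {h : ℝ} (hh : 0 < h) {F : Euc d → ℝ≥0∞}
    (hF : Measurable F) :
    ∫⁻ w, F (initE w) ∂(gaussianNoise (d + 1) h) =
      ∫⁻ v, ENNReal.ofReal (gaussianProfile d h (‖v‖ ^ 2)) * F v := by
  have hm : Measurable fun v : Euc d => ENNReal.ofReal (gaussianProfile d h (‖v‖ ^ 2)) * F v := by
    unfold gaussianProfile
    fun_prop
  have hFh : Measurable fun w : Euc d => F (h • w) := by fun_prop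
  have h1 : ∀ w : Euc (d + 1), F (initE (h • w)) = F (h • initE w) := fun w => rfl
  have hFi : Measurable fun w : Euc (d + 1) => F (initE w) := hF.comp measurable_initE
  rw [gaussianNoise, lintegral_map hFi (by fun_prop)]
  simp_rw [h1]
  rw [← lintegral_map hFh measurable_initE, map_initE_stdGaussian, lintegral_stdGaussian hFh,
    lintegral_comp_smul_Euc hm hh, ← lintegral_const_mul]
  · refine lintegral_congr fun v => ?_
    rw [← mul_assoc, ← ENNReal.ofReal_mul (by positivity)]
    congr 2
    rw [norm_smul, Real.norm_of_nonneg hh.le, gaussianProfile, gaussianProfile, mul_pow _ h]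
    field_simp
  · exact hm.comp (measurable_const_smul h)

/-- The north pole. -/
noncomputable def northPole (d : ℕ) : Sph d := nrm (snocE 0 1)

theorem northPole_coe (d : ℕ) : (northPole d).1 = snocE 0 1 := by
  have h1 := norm_snocE_sq (0 : Euc d) 1
  have h2 : ‖snocE (0 : Euc d) 1‖ = 1 := by
    simp only [norm_zero] at h1
    nlinarith [norm_nonneg (snocE (0 : Euc d) 1)]
  rw [northPole, nrm_coe (snocE_one_ne_zero 0), h2, inv_one, one_smul]

theorem inner_northPole {d : ℕ} (u : Euc (d + 1)) :
    inner ℝ (northPole d).1 u = u (Fin.last d) := by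
  rw [northPole_coe, PiLp.inner_apply, Fin.sum_univ_castSucc]
  simp

theorem propose_northPole {d : ℕ} (w : Euc (d + 1)) :
    propose (northPole d) w = nrm (snocE (initE w) 1) := by
  have h : (northPole d).1 + tangent (northPole d) w = snocE (initE w) 1 := by
    rw [tangent, inner_northPole, norm_eq_of_mem_sphere, northPole_coe]
    refine ext_snocE (fun i => ?_) ?_ <;> simp [initE]
  refine Subtype.ext ?_
  rw [nrm_coe (snocE_one_ne_zero _), ← h]
  rfl

/-- The density of the proposal `Q_S(z, ·)` at `θ` with respect to `surf`, as a function of the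
inner product of `z` and `θ`. -/
noncomputable def propDensity (d : ℕ) (h c : ℝ) : ℝ≥0∞ :=
  if 0 < c then ENNReal.ofReal ((d + 1) * (c ^ (d + 1))⁻¹ * gaussianProfile d h ((c ^ 2)⁻¹ - 1))
  else 0

theorem measurable_propDensity (d : ℕ) (h : ℝ) : Measurable (propDensity d h) := by
  refine Measurable.ite measurableSet_Ioi ?_ measurable_const
  unfold gaussianProfile
  fun_prop

theorem measurable_propDensity_inner (d : ℕ) (h : ℝ) :
    Measurable fun p : Sph d × Sph d => propDensity d h (inner ℝ p.1.1 p.2.1) :=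
  (measurable_propDensity d h).comp (by fun_prop)

theorem measurable_propDensity_inner_right {d : ℕ} (h : ℝ) (z : Sph d) :
    Measurable fun θ : Sph d => propDensity d h (inner ℝ z.1 θ.1) :=
  (measurable_propDensity d h).comp (by fun_prop)

theorem proposalKernel_northPole_apply {d : ℕ} (h : ℝ) {A : Set (Sph d)} (hA : MeasurableSet A) :
    proposalKernel d h (northPole d) A =
      ∫⁻ w, A.indicator 1 (nrm (snocE (initE w) 1)) ∂(gaussianNoise (d + 1) h) := by
  rw [← lintegral_indicator_one hA]
  refine (lintegral_map (measurable_one.indicator hA) (measurable_propose_right _)).trans ?_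
  exact lintegral_congr fun w => by rw [propose_northPole]

/-- The proposal is `(v, 1) / ‖(v, 1)‖` with `v` Gaussian, that is, `v` in gnomonic coordinates. Its
height is `c = 1 / ‖(v, 1)‖`, so `‖v‖² = c⁻² - 1`; dividing the Gaussian density by the Jacobian `c
^ (d + 1) / (d + 1)` gives `propDensity`. -/
theorem proposalKernel_northPole {d : ℕ} {h : ℝ} (hh : 0 < h) :
    proposalKernel d h (northPole d) =
      (surf d).withDensity fun θ => propDensity d h (inner ℝ (northPole d).1 θ.1) := by
  ext A hA
  have hp := measurable_propDensity_inner_right h (northPole d)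
  have hind : Measurable fun v : Euc d => A.indicator (1 : Sph d → ℝ≥0∞) (nrm (snocE v 1)) :=
    (measurable_one.indicator hA).comp
      (measurable_nrm.comp (measurable_id.snocE measurable_const))
  have e1 := proposalKernel_northPole_apply h hA
  rw [e1, lintegral_gaussianNoise_initE hh hind, withDensity_apply _ hA,
    ← lintegral_indicator hA, lintegral_surf_gnomonic (hp.indicator hA)]
  · refine lintegral_congr fun v => ?_
    have hv := norm_pos_iff.2 (snocE_one_ne_zero v)
    by_cases hvA : nrm (snocE v 1) ∈ A
    · simp only [Set.indicator_of_mem hvA, inner_northPole, Pi.one_apply, mul_one]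
      rw [nrm_last _ (snocE_one_ne_zero v), snocE_last, mul_one, propDensity,
        if_pos (inv_pos.2 hv), ← ENNReal.ofReal_mul]
      · congr 1
        rw [inv_pow, inv_pow, inv_inv, inv_inv, norm_snocE_sq, one_pow, add_sub_cancel_right]
        field_simp
      · have := gaussianProfile_pos (d := d) hh (((‖snocE v 1‖⁻¹) ^ 2)⁻¹ - 1)
        positivity
    · simp [Set.indicator_of_notMem hvA]
  · intro z hz
    by_cases hzA : z ∈ A
    · rw [Set.indicator_of_mem hzA, inner_northPole, propDensity, if_neg (not_lt.2 hz)]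
    · exact Set.indicator_of_notMem hzA _

/-! ### Invariance of the proposal under linear isometries -/

/-- The action of a linear isometry on the sphere. -/
noncomputable def sphMap {d : ℕ} (U : Euc (d + 1) ≃ₗᵢ[ℝ] Euc (d + 1)) (z : Sph d) : Sph d :=
  ⟨U z.1, by simp⟩

theorem measurable_sphMap {d : ℕ} (U : Euc (d + 1) ≃ₗᵢ[ℝ] Euc (d + 1)) : Measurable (sphMap U) :=
  (U.continuous.measurable.comp measurable_subtype_coe).subtype_mk

theorem propose_sphMap {d : ℕ} (U : Euc (d + 1) ≃ₗᵢ[ℝ] Euc (d + 1)) (z : Sph d)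
    (w : Euc (d + 1)) : propose (sphMap U z) (U w) = sphMap U (propose z w) := by
  have h : (sphMap U z).1 + tangent (sphMap U z) (U w) = U (z.1 + tangent z w) := by
    simp [sphMap, tangent]
  refine Subtype.ext ?_
  change (‖(sphMap U z).1 + tangent (sphMap U z) (U w)‖)⁻¹ • _ = U (_ • _)
  rw [h, U.norm_map, map_smul]

theorem map_sphMap_surf {d : ℕ} (U : Euc (d + 1) ≃ₗᵢ[ℝ] Euc (d + 1)) :
    (surf d).map (sphMap U) = surf d := by
  refine Measure.ext_of_lintegral _ fun G hG => ?_
  have hGU : Measurable fun z => G (sphMap U z) := hG.comp (measurable_sphMap U)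
  rw [lintegral_map hG (measurable_sphMap U), lintegral_surf hGU,
    lintegral_surf hG, ← U.measurePreserving.lintegral_comp (measurable_ball_weight hG)]
  have h0 : ∀ᵐ u : Euc (d + 1), u ≠ 0 := by simp [ae_iff]
  refine lintegral_congr_ae ?_
  filter_upwards [h0] with u hu
  have : sphMap U (nrm u) = nrm (U u) := by
    refine Subtype.ext ?_
    rw [nrm_coe (by simpa using hu)]
    simp [sphMap, nrm_coe hu]
  simp [this]

theorem map_gaussianNoise {n : ℕ} (h : ℝ) (U : Euc n ≃ₗᵢ[ℝ] Euc n) :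
    (gaussianNoise n h).map U = gaussianNoise n h := by
  have hU : Measurable U := U.continuous.measurable
  have hs : Measurable fun w : Euc n => h • w := by fun_prop
  rw [gaussianNoise, Measure.map_map hU hs]
  have : U ∘ (fun w : Euc n => h • w) = (fun w => h • w) ∘ U := by ext1 w; simp
  rw [this, ← Measure.map_map hs hU, stdGaussian_map]

/-- The reflection in the hyperplane orthogonal to the difference of two unit vectors exchanges
them. -/
theorem exists_sphMap_northPole {d : ℕ} (z : Sph d) :
    ∃ U : Euc (d + 1) ≃ₗᵢ[ℝ] Euc (d + 1), sphMap U (northPole d) = z :=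
  ⟨_, Subtype.ext (Submodule.reflection_sub
    ((norm_eq_of_mem_sphere (northPole d)).trans (norm_eq_of_mem_sphere z).symm))⟩

/-- The proposal has a density with respect to `surf` that depends on the inner product only. -/
theorem proposalKernel_eq_withDensity {d : ℕ} {h : ℝ} (hh : 0 < h) (z : Sph d) :
    proposalKernel d h z =
      (surf d).withDensity fun θ => propDensity d h (inner ℝ z.1 θ.1) := by
  obtain ⟨U, rfl⟩ := exists_sphMap_northPole z
  have hUm := measurable_sphMap U
  -- The noise is invariant under `U`, and `propose` commutes with `U`; so the proposal from the
  -- image point is the image of the proposal from the pole.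
  have e1 : proposalKernel d h (sphMap U (northPole d)) =
      (proposalKernel d h (northPole d)).map (sphMap U) := by
    change (gaussianNoise (d + 1) h).map _ = ((gaussianNoise (d + 1) h).map _).map _
    rw [Measure.map_map hUm (measurable_propose_right _)]
    conv_lhs => rw [← map_gaussianNoise h U]
    rw [Measure.map_map (measurable_propose_right _) U.continuous.measurable]
    congr 1
    ext1 w
    exact propose_sphMap U _ w
  have hp := measurable_propDensity_inner_right (d := d) h
  ext A hA
  rw [e1, proposalKernel_northPole hh, Measure.map_apply hUm hA, withDensity_apply _ (hUm hA),
    withDensity_apply _ hA, ← lintegral_indicator hA, ← lintegral_indicator (hUm hA)]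
  conv_rhs => rw [← map_sphMap_surf U, lintegral_map ((hp _).indicator hA) hUm]
  refine lintegral_congr fun θ => ?_
  have : inner ℝ (sphMap U (northPole d)).1 (sphMap U θ).1 = inner ℝ (northPole d).1 θ.1 :=
    U.inner_map_map _ _
  by_cases hθ : sphMap U θ ∈ A
  · rw [Set.indicator_of_mem hθ, Set.indicator_of_mem (by exact hθ), this]
  · rw [Set.indicator_of_notMem hθ, Set.indicator_of_notMem (by exact hθ)]

theorem exists_propDensity_ge (d : ℕ) {h : ℝ} (hh : 0 < h) :
    ∃ ε : ℝ≥0∞, ε ≠ 0 ∧ ∀ c : ℝ, 1 / 2 ≤ c → c ≤ 1 → ε ≤ propDensity d h c := by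
  -- The profile decreases in the squared tangential length `c⁻² - 1`, which is `3` at the worst
  -- value `c = 1 / 2`; the remaining factor is at least 1.
  refine ⟨ENNReal.ofReal (gaussianProfile d h 3), by simp [gaussianProfile_pos hh], fun c h1 h2 => ?_⟩
  have hc : 0 < c := by linarith
  rw [propDensity, if_pos hc]
  refine ENNReal.ofReal_le_ofReal ?_
  have e1 : gaussianProfile d h 3 ≤ gaussianProfile d h ((c ^ 2)⁻¹ - 1) := by
    have : (c ^ 2)⁻¹ ≤ 4 := by
      rw [inv_le_comm₀ (by positivity) (by norm_num)]
      nlinarith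
    unfold gaussianProfile
    gcongr
    linarith
  have e2 : 1 ≤ (c ^ (d + 1))⁻¹ := (one_le_inv₀ (by positivity)).2 (pow_le_one₀ hc.le h2)
  have e3 : (1 : ℝ) ≤ (d + 1) * (c ^ (d + 1))⁻¹ := by
    have : (0 : ℝ) ≤ d := d.cast_nonneg
    nlinarith
  have := gaussianProfile_pos (d := d) hh 3
  nlinarith

/-! ### The transition kernel of multiple-try Metropolis -/

/-- The probability of selecting `y` among `y` and the further candidates `c`. -/
noncomputable def mtmWeight {d n : ℕ} (ω : WeightFunction d) (z y : Sph d) (c : Fin n → Sph d) :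
    ℝ :=
  ω.toFun z y / (∑ i, ω.toFun z (c i) + ω.toFun z y)

/-- The acceptance probability in terms of the selected candidate `y`, the other candidates `c`
and the balancing points `r`. -/
noncomputable def mtmAccept {d n : ℕ} (R : ℝ) (π : Euc d → ℝ) (ω : WeightFunction d) (z y : Sph d)
    (c r : Fin n → Sph d) : ℝ :=
  min 1 (sphDensity R π y * mtmWeight ω y z r / (sphDensity R π z * mtmWeight ω z y c))

section

variable {d n : ℕ} {R : ℝ} {π : Euc d → ℝ} {ω : WeightFunction d}

theorem mtmWeight_pos (ω : WeightFunction d) (z y : Sph d) (c : Fin n → Sph d) :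
    0 < mtmWeight ω z y c :=
  div_pos (ω.pos _ _) (add_pos_of_nonneg_of_pos (Finset.sum_nonneg fun _ _ => (ω.pos _ _).le)
    (ω.pos _ _))

theorem measurable_mtmWeight {α : Type*} [MeasurableSpace α] (ω : WeightFunction d)
    {f g : α → Sph d} {c : α → Fin n → Sph d} (hf : Measurable f) (hg : Measurable g)
    (hc : Measurable c) : Measurable fun a => mtmWeight ω (f a) (g a) (c a) := by
  have h {g' : α → Sph d} (hg' : Measurable g') : Measurable fun a => ω.toFun (f a) (g' a) :=
    ω.measurable.comp (hf.prodMk hg')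
  exact (h hg).div ((Finset.measurable_sum _ fun i _ =>
    h ((measurable_pi_apply i).comp hc)).add (h hg))

theorem measurable_mtmAccept {α : Type*} [MeasurableSpace α] (R : ℝ) (hcont : Continuous π)
    (ω : WeightFunction d) {f g : α → Sph d} {c r : α → Fin n → Sph d} (hf : Measurable f)
    (hg : Measurable g) (hc : Measurable c) (hr : Measurable r) :
    Measurable fun a => mtmAccept R π ω (f a) (g a) (c a) (r a) := by
  have hπ := measurable_sphDensity R hcont
  exact measurable_const.min (((hπ.comp hg).mul (measurable_mtmWeight ω hg hf hr)).div
    ((hπ.comp hf).mul (measurable_mtmWeight ω hf hg hc)))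

theorem selectProb_eq_mtmWeight (ω : WeightFunction d) (z : Sph d) (c : Fin (n + 1) → Sph d)
    (j : Fin (n + 1)) :
    selectProb ω z c j = mtmWeight ω z (c j) fun i => c (j.succAbove i) := by
  rw [selectProb, mtmWeight, Fin.sum_univ_succAbove _ j, add_comm]

theorem acceptProb_eq_mtmAccept (z : Sph d) (c : Fin (n + 1) → Sph d) (j : Fin (n + 1))
    (r : Fin n → Sph d) :
    acceptProb (N := n + 1) R π ω z c j r =
      mtmAccept R π ω z (c j) (fun i => c (j.succAbove i)) r := by
  rw [acceptProb, mtmAccept, mtmWeight, mtmWeight, Fin.sum_univ_succAbove _ j,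
    add_comm (ω.toFun z (c j)), ← mul_div_assoc, ← mul_div_assoc]
  rfl

/-- The selection probability cancels the denominator of the acceptance ratio. The resulting minimum
carries both reversibility and the lower bound. -/
theorem mtmWeight_mul_mtmAccept (hR : 0 < R) (hpos : ∀ x, 0 < π x) (z y : Sph d)
    (c r : Fin n → Sph d) :
    mtmWeight ω z y c * mtmAccept R π ω z y c r =
      min (mtmWeight ω z y c) (sphDensity R π y / sphDensity R π z * mtmWeight ω y z r) := by
  have hw := mtmWeight_pos ω z y c
  have hz := sphDensity_pos hR hpos z
  rw [mtmAccept, mul_min_of_nonneg _ _ hw.le]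
  congr 1
  · ring
  · field_simp

/-- The density of the accepted moves with respect to the proposal, up to the number of
candidates. -/
noncomputable def acceptMass (n : ℕ) (R h : ℝ) (π : Euc d → ℝ) (ω : WeightFunction d)
    (z y : Sph d) : ℝ≥0∞ :=
  ∫⁻ c, ∫⁻ r, ENNReal.ofReal (mtmWeight ω z y c) * ENNReal.ofReal (mtmAccept R π ω z y c r)
    ∂(iid (proposalKernel d h) n y) ∂(iid (proposalKernel d h) n z)

/-- The probability of rejection, up to the number of candidates. -/
noncomputable def rejectMass (n : ℕ) (R h : ℝ) (π : Euc d → ℝ) (ω : WeightFunction d)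
    (z : Sph d) : ℝ≥0∞ :=
  ∫⁻ y, ∫⁻ c, ∫⁻ r,
    ENNReal.ofReal (mtmWeight ω z y c) * ENNReal.ofReal (1 - mtmAccept R π ω z y c r)
    ∂(iid (proposalKernel d h) n y) ∂(iid (proposalKernel d h) n z) ∂(proposalKernel d h z)

theorem measurable_lintegral_iid {α : Type*} [MeasurableSpace α] (h : ℝ)
    {f : α → (Fin n → Sph d) → ℝ≥0∞} (hf : Measurable (Function.uncurry f)) {g : α → Sph d}
    (hg : Measurable g) : Measurable fun a => ∫⁻ r, f a r ∂(iid (proposalKernel d h) n (g a)) :=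
  Measurable.lintegral_kernel_prod_right' (κ := (iid (proposalKernel d h) n).comap g hg) hf

theorem measurable_acceptMass (R h : ℝ) (hcont : Continuous π) (ω : WeightFunction d) :
    Measurable fun p : Sph d × Sph d => acceptMass n R h π ω p.1 p.2 := by
  refine measurable_lintegral_iid h ?_ measurable_fst
  refine measurable_lintegral_iid h ?_ (g := fun p : (Sph d × Sph d) × (Fin n → Sph d) => p.1.2)
    (by fun_prop)
  exact (measurable_mtmWeight ω (by fun_prop) (by fun_prop) (by fun_prop)).ennreal_ofReal.mul
    (measurable_mtmAccept R hcont ω (by fun_prop) (by fun_prop) (by fun_prop)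
      (by fun_prop)).ennreal_ofReal

theorem lintegral_selectKernel {N : ℕ} (ω : WeightFunction d) (p : Sph d × (Fin N → Sph d))
    (f : Fin N → ℝ≥0∞) :
    ∫⁻ j, f j ∂(selectKernel N ω p) = ∑ j, ENNReal.ofReal (selectProb ω p.1 p.2 j) * f j := by
  change ∫⁻ j, f j ∂(∑ j, ENNReal.ofReal (selectProb ω p.1 p.2 j) • Measure.dirac j) = _
  simp [lintegral_finsetSum_measure, lintegral_smul_measure]

theorem smtmKernel_apply_eq_sum (N : ℕ) [NeZero N] (hR : 0 < R) (h : ℝ) (hcont : Continuous π)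
    (hpos : ∀ x, 0 < π x) (ω : WeightFunction d) (x : Euc d) {B : Set (Euc d)}
    (hB : MeasurableSet B) :
    smtmKernel N R hR h π hcont ω x B =
      ∫⁻ c, ∑ j, ENNReal.ofReal (selectProb ω (stereoInv R hR x) c j) *
        ∫⁻ r, (ENNReal.ofReal (acceptProb R π ω (stereoInv R hR x) c j r) *
            B.indicator 1 (stereo R (c j)) +
          ENNReal.ofReal (1 - acceptProb R π ω (stereoInv R hR x) c j r) * B.indicator 1 x)
        ∂(iid (proposalKernel d h) (N - 1) (c j))
      ∂(iid (proposalKernel d h) N (stereoInv R hR x)) := by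
  have := isMarkovKernel_acceptKernel (N := N) R hR π hcont hpos ω
  have hmB := (acceptKernel N R hR π hcont ω).measurable_coe hB
  have hm2 : Measurable fun b : ((Fin N → Sph d) × Fin N) × (Fin (N - 1) → Sph d) =>
      acceptKernel N R hR π hcont ω (x, b) B := hmB.comp measurable_prodMk_left
  rw [smtmKernel, Kernel.snd_apply' _ _ hB, Kernel.compProd_apply (measurable_snd hB)]
  change ∫⁻ b, acceptKernel N R hR π hcont ω (x, b) B ∂_ = _
  rw [Kernel.lintegral_compProd _ _ _ hm2]
  have hm3 : Measurable fun q : (Fin N → Sph d) × Fin N =>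
      ∫⁻ r, acceptKernel N R hR π hcont ω (x, (q, r)) B ∂(balancingKernel d N h (x, q)) :=
    Measurable.lintegral_kernel_prod_right'
      (κ := (balancingKernel d N h).comap (fun q => (x, q)) measurable_prodMk_left) hm2
  rw [candidateKernel, Kernel.comap_apply, Kernel.lintegral_compProd _ _ _ hm3]
  refine lintegral_congr fun c => ?_
  rw [lintegral_selectKernel]
  refine Finset.sum_congr rfl fun j _ => ?_
  congr 1
  refine lintegral_congr fun r => ?_
  simp [acceptKernel, hB]

theorem lintegral_iid_succ (h : ℝ) (z : Sph d) (j : Fin (n + 1))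
    {f : Sph d → (Fin n → Sph d) → ℝ≥0∞} (hf : Measurable (Function.uncurry f)) :
    ∫⁻ c, f (c j) (fun i => c (j.succAbove i)) ∂(iid (proposalKernel d h) (n + 1) z) =
      ∫⁻ y, ∫⁻ c, f y c ∂(iid (proposalKernel d h) n z) ∂(proposalKernel d h z) := by
  have hp := measurePreserving_piFinSuccAbove
    (fun _ : Fin (n + 1) => proposalKernel d h z) j
  refine (hp.lintegral_comp hf).trans ?_
  exact lintegral_prod _ hf.aemeasurable

/-- The candidates are exchangeable, so each of the `n + 1` indices contributes the same: draw the
selected candidate `y` first and the other `n` independently. This separates the accepted moves from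
the mass that stays at `x`. -/
theorem smtmKernel_apply_eq_add (hR : 0 < R) (h : ℝ) (hcont : Continuous π)
    (hpos : ∀ x, 0 < π x) (ω : WeightFunction d) (x : Euc d) {B : Set (Euc d)}
    (hB : MeasurableSet B) :
    smtmKernel (n + 1) R hR h π hcont ω x B =
      (n + 1) * (∫⁻ y, acceptMass n R h π ω (stereoInv R hR x) y * B.indicator 1 (stereo R y)
        ∂(proposalKernel d h (stereoInv R hR x))) +
      (n + 1) * rejectMass n R h π ω (stereoInv R hR x) * B.indicator 1 x := by
  set z := stereoInv R hR x
  have hind : Measurable fun y : Sph d => B.indicator (1 : Euc d → ℝ≥0∞) (stereo R y) :=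
    (measurable_one.indicator hB).comp (measurable_stereo R)
  have hW : Measurable fun p : (Sph d × (Fin n → Sph d)) × (Fin n → Sph d) =>
      ENNReal.ofReal (mtmWeight ω z p.1.1 p.1.2) :=
    (measurable_mtmWeight ω measurable_const (by fun_prop) (by fun_prop)).ennreal_ofReal
  have hA : Measurable fun p : (Sph d × (Fin n → Sph d)) × (Fin n → Sph d) =>
      mtmAccept R π ω z p.1.1 p.1.2 p.2 :=
    measurable_mtmAccept R hcont ω measurable_const (by fun_prop) (by fun_prop) (by fun_prop)
  have hAB : Measurable fun p : (Sph d × (Fin n → Sph d)) × (Fin n → Sph d) =>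
      ENNReal.ofReal (mtmAccept R π ω z p.1.1 p.1.2 p.2) * B.indicator 1 (stereo R p.1.1) :=
    hA.ennreal_ofReal.mul (hind.comp (by fun_prop))
  set f : Sph d → (Fin n → Sph d) → ℝ≥0∞ := fun y c => ENNReal.ofReal (mtmWeight ω z y c) *
      ∫⁻ r, (ENNReal.ofReal (mtmAccept R π ω z y c r) * B.indicator 1 (stereo R y) +
        ENNReal.ofReal (1 - mtmAccept R π ω z y c r) * B.indicator 1 x)
      ∂(iid (proposalKernel d h) n y) with hf
  have hfm : Measurable (Function.uncurry f) := by
    refine Measurable.mul (hW.comp (measurable_id.prodMk measurable_snd)) ?_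
    refine measurable_lintegral_iid h ?_ measurable_fst
    exact hAB.add ((hA.const_sub 1).ennreal_ofReal.mul_const _)
  have e1 : smtmKernel (n + 1) R hR h π hcont ω x B =
      ∫⁻ c, ∑ j, f (c j) (fun i => c (j.succAbove i))
        ∂(iid (proposalKernel d h) (n + 1) z) := by
    rw [smtmKernel_apply_eq_sum (n + 1) hR h hcont hpos ω x hB]
    refine lintegral_congr fun c => Finset.sum_congr rfl fun j _ => ?_
    rw [selectProb_eq_mtmWeight]
    simp_rw [acceptProb_eq_mtmAccept]
    rfl
  have hfj (j : Fin (n + 1)) :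
      Measurable fun c : Fin (n + 1) → Sph d => f (c j) (fun i => c (j.succAbove i)) := by
    have hg : Measurable fun c : Fin (n + 1) → Sph d => (c j, fun i => c (j.succAbove i)) := by
      fun_prop
    exact hfm.comp hg
  rw [e1, lintegral_finsetSum _ fun j _ => hfj j]
  simp_rw [lintegral_iid_succ h z _ hfm]
  rw [Finset.sum_const, Finset.card_univ, Fintype.card_fin, nsmul_eq_mul, mul_assoc, ← mul_add]
  push_cast
  congr 1
  have hsplit (y : Sph d) (c : Fin n → Sph d) : f y c =
      (∫⁻ r, ENNReal.ofReal (mtmWeight ω z y c) * ENNReal.ofReal (mtmAccept R π ω z y c r)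
        ∂(iid (proposalKernel d h) n y)) * B.indicator 1 (stereo R y) +
      (∫⁻ r, ENNReal.ofReal (mtmWeight ω z y c) * ENNReal.ofReal (1 - mtmAccept R π ω z y c r)
        ∂(iid (proposalKernel d h) n y)) * B.indicator 1 x := by
    have hr : Measurable fun r => mtmAccept R π ω z y c r :=
      measurable_mtmAccept R hcont ω measurable_const measurable_const measurable_const measurable_id
    rw [hf]
    simp only
    rw [lintegral_add_left (hr.ennreal_ofReal.mul_const _),
      lintegral_mul_const _ hr.ennreal_ofReal, lintegral_mul_const _ (by fun_prop),
      lintegral_const_mul _ hr.ennreal_ofReal, lintegral_const_mul _ (by fun_prop)]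
    ring
  have hI1 : Measurable (Function.uncurry fun (y : Sph d) (c : Fin n → Sph d) =>
      ∫⁻ r, ENNReal.ofReal (mtmWeight ω z y c) * ENNReal.ofReal (mtmAccept R π ω z y c r)
        ∂(iid (proposalKernel d h) n y)) :=
    measurable_lintegral_iid h (hW.mul hA.ennreal_ofReal) measurable_fst
  have hI2 : Measurable (Function.uncurry fun (y : Sph d) (c : Fin n → Sph d) =>
      ∫⁻ r, ENNReal.ofReal (mtmWeight ω z y c) * ENNReal.ofReal (1 - mtmAccept R π ω z y c r)
        ∂(iid (proposalKernel d h) n y)) :=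
    measurable_lintegral_iid h (hW.mul (hA.const_sub 1).ennreal_ofReal) measurable_fst
  have hsplit2 (y : Sph d) : ∫⁻ c, f y c ∂(iid (proposalKernel d h) n z) =
      acceptMass n R h π ω z y * B.indicator 1 (stereo R y) +
      (∫⁻ c, ∫⁻ r, ENNReal.ofReal (mtmWeight ω z y c) *
        ENNReal.ofReal (1 - mtmAccept R π ω z y c r)
        ∂(iid (proposalKernel d h) n y) ∂(iid (proposalKernel d h) n z)) * B.indicator 1 x := by
    simp_rw [hsplit]
    rw [lintegral_add_left (hI1.of_uncurry_left.mul_const _),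
      lintegral_mul_const _ hI1.of_uncurry_left,
      lintegral_mul_const _ hI2.of_uncurry_left, acceptMass]
  simp_rw [hsplit2]
  rw [lintegral_add_left, lintegral_mul_const, rejectMass]
  · exact measurable_lintegral_iid h (hI2.comp measurable_id) (g := fun _ => z) measurable_const
  · exact (measurable_section (measurable_acceptMass R h hcont ω) z).mul hind

end

/-! ### Reversibility and minorization -/

section

variable {d n : ℕ} {R h : ℝ} {π : Euc d → ℝ} {ω : WeightFunction d}

theorem stereo_stereoInv (hR : 0 < R) (x : Euc d) : stereo R (stereoInv R hR x) = x := by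
  have hn : 0 < ‖x‖ ^ 2 + R ^ 2 := by positivity
  have h1 : 1 - (‖x‖ ^ 2 - R ^ 2) / (‖x‖ ^ 2 + R ^ 2) = 2 * R ^ 2 / (‖x‖ ^ 2 + R ^ 2) := by
    field_simp; ring
  ext i
  simp only [stereo, stereoInv, stereoInvVec, Fin.snoc_castSucc, Fin.snoc_last, h1]
  field_simp

theorem sphDensity_stereoInv (hR : 0 < R) (x : Euc d) :
    sphDensity R π (stereoInv R hR x) = π x * (‖x‖ ^ 2 + R ^ 2) ^ d := by
  rw [sphDensity, stereo_stereoInv, add_comm]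

theorem exists_sphDensity_le (hbdd : BddAbove (Set.range fun x : Euc d =>
    π x * (R ^ 2 + ‖x‖ ^ 2) ^ d)) : ∃ M : ℝ, 0 < M ∧ ∀ z, sphDensity R π z ≤ M := by
  obtain ⟨M, hM⟩ := hbdd
  -- The default value of `stereo` at the pole lies in `ℝ^d`, so the bound covers the pole too.
  exact ⟨max M 1, by positivity, fun z => (hM ⟨stereo R z, rfl⟩).trans (le_max_left _ _)⟩

/-- The function `(‖x‖² + R²)⁻ᵈ` is, up to a constant, the density of `surf` in stereographic
coordinates; its integral is finite because the sphere has finite mass, and it dominates `π`. -/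
theorem integrable_of_bddAbove (hd : d ≠ 0) (hR : 0 < R) (hcont : Continuous π)
    (hpos : ∀ x, 0 < π x) (hbdd : BddAbove (Set.range fun x : Euc d =>
      π x * (R ^ 2 + ‖x‖ ^ 2) ^ d)) : Integrable π := by
  obtain ⟨M, hM0, hM⟩ := exists_sphDensity_le hbdd
  have hint : Integrable fun x : Euc d => ((‖x‖ ^ 2 + R ^ 2) ^ d)⁻¹ := by
    refine ⟨Continuous.aestronglyMeasurable ?_, ?_⟩
    · have (x : Euc d) : (‖x‖ ^ 2 + R ^ 2) ^ d ≠ 0 := by positivity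
      fun_prop (disch := assumption)
    · rw [hasFiniteIntegral_iff_ofReal (.of_forall fun x => by positivity)]
      have h1 := lintegral_surf_stereographic hd hR (measurable_one (α := ℝ≥0∞) (β := Sph d))
      simp only [Pi.one_apply, one_mul, lintegral_one] at h1
      refine lt_top_iff_ne_top.2 fun htop => measure_ne_top (surf d) Set.univ ?_
      rw [h1, htop, ENNReal.mul_top]
      have : 0 < (2 * R) ^ d / ((d : ℝ) + 1) := by positivity
      simpa using this
  refine (hint.const_mul M).mono' hcont.aestronglyMeasurable (.of_forall fun x => ?_)
  have := hM (stereoInv R hR x)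
  rw [sphDensity_stereoInv] at this
  rw [Real.norm_of_nonneg (hpos x).le, ← div_eq_mul_inv]
  exact (le_div_iff₀ (by positivity)).2 this

theorem integral_pos_of_pos (hcont : Continuous π) (hpos : ∀ x, 0 < π x)
    (hint : Integrable π) : 0 < ∫ x, π x :=
  integral_pos_of_integrable_nonneg_nonzero hcont hint (fun x => (hpos x).le) (hpos 0).ne'

theorem isProbabilityMeasure_targetMeasure (hint : Integrable π) (hpos : ∀ x, 0 < π x)
    (hZ : 0 < ∫ x, π x) : IsProbabilityMeasure (targetMeasure π) := by
  refine ⟨?_⟩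
  rw [targetMeasure, withDensity_apply _ MeasurableSet.univ, Measure.restrict_univ,
    ← ofReal_integral_eq_lintegral_ofReal (hint.div_const _)
      (.of_forall fun x => (div_pos (hpos x) hZ).le), integral_div, div_self hZ.ne',
    ENNReal.ofReal_one]

/-- The target distribution corresponds to `π_S` on the sphere. -/
theorem exists_lintegral_surf_eq (hd : d ≠ 0) (hR : 0 < R) (hcont : Continuous π)
    (hZ : 0 < ∫ x, π x) :
    ∃ c : ℝ≥0∞, c ≠ 0 ∧ c ≠ ∞ ∧ ∀ G : Sph d → ℝ≥0∞, Measurable G →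
      ∫⁻ z, ENNReal.ofReal (sphDensity R π z) * G z ∂(surf d) =
        c * ∫⁻ x, G (stereoInv R hR x) ∂(targetMeasure π) := by
  have hC : 0 < (2 * R) ^ d / ((d : ℝ) + 1) * ∫ x, π x := by positivity
  refine ⟨ENNReal.ofReal ((2 * R) ^ d / (d + 1) * ∫ x, π x), by simpa using hC,
    ENNReal.ofReal_ne_top, fun G hG => ?_⟩
  have hGs : Measurable fun x => G (stereoInv R hR x) := hG.comp (measurable_stereoInv R hR)
  have hπ : Measurable fun x => ENNReal.ofReal (π x / ∫ y, π y) :=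
    (hcont.measurable.div_const _).ennreal_ofReal
  have hG' : Measurable fun z => ENNReal.ofReal (sphDensity R π z) * G z :=
    (measurable_sphDensity R hcont).ennreal_ofReal.mul hG
  rw [lintegral_surf_stereographic hd hR hG',
    targetMeasure, lintegral_withDensity_eq_lintegral_mul _ hπ hGs,
    ENNReal.ofReal_mul (by positivity), mul_assoc, ← lintegral_const_mul _ (hπ.mul hGs)]
  congr 1
  refine lintegral_congr fun x => ?_
  have hn : 0 < ‖x‖ ^ 2 + R ^ 2 := by positivity
  simp only [Pi.mul_apply]
  rw [← mul_assoc, ← ENNReal.ofReal_mul hZ.le, mul_right_comm, ← ENNReal.ofReal_mul' (by positivity),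
    sphDensity_stereoInv]
  congr 2
  field_simp

/-- Both sides integrate the minimum of `π_S(z) w(z,y;c)` and `π_S(y) w(y,z;r)`. Exchanging `z` and
`y` exchanges the roles of the other candidates and the balancing points, which is why the algorithm
draws the latter. -/
theorem sphDensity_mul_acceptMass_symm (hR : 0 < R) (hpos : ∀ x, 0 < π x)
    (ω : WeightFunction d) (z y : Sph d) :
    ENNReal.ofReal (sphDensity R π z) * acceptMass n R h π ω z y =
      ENNReal.ofReal (sphDensity R π y) * acceptMass n R h π ω y z := by
  have key (z y : Sph d) : ENNReal.ofReal (sphDensity R π z) * acceptMass n R h π ω z y =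
      ∫⁻ c, ∫⁻ r, ENNReal.ofReal (min (sphDensity R π z * mtmWeight ω z y c)
        (sphDensity R π y * mtmWeight ω y z r))
        ∂(iid (proposalKernel d h) n y) ∂(iid (proposalKernel d h) n z) := by
    have hz := sphDensity_pos hR hpos z
    rw [acceptMass, ← lintegral_const_mul' _ _ ENNReal.ofReal_ne_top]
    refine lintegral_congr fun c => ?_
    rw [← lintegral_const_mul' _ _ ENNReal.ofReal_ne_top]
    refine lintegral_congr fun r => ?_
    rw [← ENNReal.ofReal_mul (mtmWeight_pos ω z y c).le, mtmWeight_mul_mtmAccept hR hpos,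
      ← ENNReal.ofReal_mul hz.le, mul_min_of_nonneg _ _ hz.le]
    congr 2
    field_simp
  rw [key, key, lintegral_lintegral_swap]
  · simp_rw [min_comm]
  · refine (Measurable.ennreal_ofReal (Measurable.min ?_ ?_)).aemeasurable
    · exact (measurable_mtmWeight ω measurable_const measurable_const measurable_fst).const_mul _
    · exact (measurable_mtmWeight ω measurable_const measurable_const measurable_snd).const_mul _

theorem measurable_indicator_stereo (R : ℝ) {A : Set (Euc d)} (hA : MeasurableSet A) :
    Measurable fun y : Sph d => A.indicator (1 : Euc d → ℝ≥0∞) (stereo R y) :=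
  (measurable_one.indicator hA).comp (measurable_stereo R)

/-- The probability of an accepted move from `z` to the projection of `B`, up to the number of
candidates. -/
noncomputable def acceptProbTo (n : ℕ) (R h : ℝ) (π : Euc d → ℝ) (ω : WeightFunction d)
    (B : Set (Euc d)) (z : Sph d) : ℝ≥0∞ :=
  ∫⁻ y, acceptMass n R h π ω z y * B.indicator 1 (stereo R y) ∂(proposalKernel d h z)

theorem measurable_acceptProbTo (R h : ℝ) (hcont : Continuous π) (ω : WeightFunction d)
    {B : Set (Euc d)} (hB : MeasurableSet B) : Measurable (acceptProbTo n R h π ω B) := by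
  refine Measurable.lintegral_kernel_prod_right' (κ := proposalKernel d h)
    (f := fun p => acceptMass n R h π ω p.1 p.2 * B.indicator 1 (stereo R p.2)) ?_
  exact (measurable_acceptMass R h hcont ω).mul
    ((measurable_indicator_stereo R hB).comp measurable_snd)

theorem lintegral_acceptProbTo (hh : 0 < h) (hcont : Continuous π) (ω : WeightFunction d)
    (A : Set (Euc d)) {B : Set (Euc d)} (hB : MeasurableSet B) :
    ∫⁻ z, ENNReal.ofReal (sphDensity R π z) *
        (A.indicator 1 (stereo R z) * acceptProbTo n R h π ω B z) ∂(surf d) =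
      ∫⁻ z, ∫⁻ y, propDensity d h (inner ℝ z.1 y.1) *
        (ENNReal.ofReal (sphDensity R π z) * acceptMass n R h π ω z y) *
        (A.indicator 1 (stereo R z) * B.indicator 1 (stereo R y)) ∂(surf d) ∂(surf d) := by
  refine lintegral_congr fun z => ?_
  have hm : Measurable fun y => acceptMass n R h π ω z y * B.indicator 1 (stereo R y) :=
    (measurable_section (measurable_acceptMass R h hcont ω) z).mul
      (measurable_indicator_stereo R hB)
  rw [acceptProbTo, proposalKernel_eq_withDensity hh, lintegral_withDensity_eq_lintegral_mul _
    (measurable_propDensity_inner_right h z) hm, ← mul_assoc, ← lintegral_const_mul _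
    ((measurable_propDensity_inner_right h z).mul hm)]
  refine lintegral_congr fun y => ?_
  simp only [Pi.mul_apply]
  ring

theorem lintegral_acceptProbTo_symm (hR : 0 < R) (hh : 0 < h) (hcont : Continuous π)
    (hpos : ∀ x, 0 < π x) (ω : WeightFunction d) {A B : Set (Euc d)} (hA : MeasurableSet A)
    (hB : MeasurableSet B) :
    ∫⁻ z, ENNReal.ofReal (sphDensity R π z) *
        (A.indicator 1 (stereo R z) * acceptProbTo n R h π ω B z) ∂(surf d) =
      ∫⁻ z, ENNReal.ofReal (sphDensity R π z) *
        (B.indicator 1 (stereo R z) * acceptProbTo n R h π ω A z) ∂(surf d) := by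
  rw [lintegral_acceptProbTo hh hcont ω A hB, lintegral_acceptProbTo hh hcont ω B hA,
    lintegral_lintegral_swap]
  · refine lintegral_congr fun z => lintegral_congr fun y => ?_
    rw [sphDensity_mul_acceptMass_symm hR hpos, real_inner_comm]
    ring
  · have h1 : Measurable fun p : Sph d × Sph d => ENNReal.ofReal (sphDensity R π p.1) :=
      ((measurable_sphDensity R hcont).comp measurable_fst).ennreal_ofReal
    exact (((measurable_propDensity_inner d h).mul (h1.mul (measurable_acceptMass R h hcont ω))).mul
      (((measurable_indicator_stereo R hA).comp measurable_fst).mul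
        ((measurable_indicator_stereo R hB).comp measurable_snd))).aemeasurable

/-- The accepted flow is symmetric by the computation on the sphere. The rejected part never leaves
`x`, so it enters through the product of the indicators of `A` and `B` and is symmetric by itself.
-/
theorem isReversible_smtmKernel (hd : d ≠ 0) (hR : 0 < R) (hh : 0 < h) (hcont : Continuous π)
    (hpos : ∀ x, 0 < π x) (hZ : 0 < ∫ x, π x) (ω : WeightFunction d) :
    Kernel.IsReversible (smtmKernel (n + 1) R hR h π hcont ω) (targetMeasure π) := by
  obtain ⟨c, hc0, hctop, hc⟩ := exists_lintegral_surf_eq hd hR hcont hZ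
  have flow {A B : Set (Euc d)} (hA : MeasurableSet A) (hB : MeasurableSet B) :
      c * ∫⁻ x, A.indicator 1 x * acceptProbTo n R h π ω B (stereoInv R hR x) ∂(targetMeasure π) =
      ∫⁻ z, ENNReal.ofReal (sphDensity R π z) *
        (A.indicator 1 (stereo R z) * acceptProbTo n R h π ω B z) ∂(surf d) := by
    have hG : Measurable fun z : Sph d =>
        A.indicator 1 (stereo R z) * acceptProbTo n R h π ω B z :=
      (measurable_indicator_stereo R hA).mul (measurable_acceptProbTo R h hcont ω hB)
    have h1 := hc _ hG
    simp only [stereo_stereoInv] at h1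
    exact h1.symm
  have flow_symm {A B : Set (Euc d)} (hA : MeasurableSet A) (hB : MeasurableSet B) :
      ∫⁻ x, A.indicator 1 x * acceptProbTo n R h π ω B (stereoInv R hR x) ∂(targetMeasure π) =
      ∫⁻ x, B.indicator 1 x * acceptProbTo n R h π ω A (stereoInv R hR x) ∂(targetMeasure π) := by
    rw [← ENNReal.mul_right_inj hc0 hctop, flow hA hB, flow hB hA]
    exact lintegral_acceptProbTo_symm hR hh hcont hpos ω hA hB
  have split {A B : Set (Euc d)} (hA : MeasurableSet A) (hB : MeasurableSet B) :
      ∫⁻ x in A, smtmKernel (n + 1) R hR h π hcont ω x B ∂(targetMeasure π) =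
      (n + 1) *
        (∫⁻ x, A.indicator 1 x * acceptProbTo n R h π ω B (stereoInv R hR x) ∂(targetMeasure π)) +
      ∫⁻ x, (n + 1) * rejectMass n R h π ω (stereoInv R hR x) *
        (A.indicator 1 x * B.indicator 1 x) ∂(targetMeasure π) := by
    have hmf : Measurable fun x : Euc d => A.indicator (1 : Euc d → ℝ≥0∞) x *
        acceptProbTo n R h π ω B (stereoInv R hR x) :=
      (measurable_one.indicator hA).mul
        ((measurable_acceptProbTo R h hcont ω hB).comp (measurable_stereoInv R hR))
    rw [← lintegral_const_mul _ hmf, ← lintegral_add_left (hmf.const_mul _),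
      ← lintegral_indicator hA]
    refine lintegral_congr fun x => ?_
    by_cases hx : x ∈ A
    · rw [Set.indicator_of_mem hx, Set.indicator_of_mem hx,
        smtmKernel_apply_eq_add hR h hcont hpos ω x hB]
      simp [acceptProbTo]
    · simp [Set.indicator_of_notMem hx]
  intro A B hA hB
  rw [split hA hB, split hB hA, flow_symm hA hB]
  congr 1
  exact lintegral_congr fun x => by rw [mul_comm (A.indicator 1 x)]

/-- Lower bound for one step of the chain. -/
theorem exists_withDensity_le_smtmKernel (hd : d ≠ 0) (hR : 0 < R) (hh : 0 < h)
    (hcont : Continuous π) (hpos : ∀ x, 0 < π x) (hZ : 0 < ∫ x, π x) (ω : WeightFunction d)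
    {M : ℝ} (hM : 0 < M)
    (hω : ∀ (z y : Sph d) (c r : Fin n → Sph d), sphDensity R π y / ((n + 1) * M) ≤
      min (mtmWeight ω z y c) (sphDensity R π y / sphDensity R π z * mtmWeight ω y z r)) :
    ∃ b : ℝ≥0∞, b ≠ 0 ∧ ∀ x, (targetMeasure π).withDensity (fun y => b *
        propDensity d h (inner ℝ (stereoInv R hR x).1 (stereoInv R hR y).1)) ≤
      smtmKernel (n + 1) R hR h π hcont ω x := by
  obtain ⟨c, hc0, hctop, hc⟩ := exists_lintegral_surf_eq hd hR hcont hZ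
  -- The number `n + 1` of candidates cancels the same factor in `(n + 1) * M`; `c` converts surface
  -- measure into the target law.
  refine ⟨ENNReal.ofReal M⁻¹ * c, mul_ne_zero (by simpa using hM) hc0, fun x => ?_⟩
  refine Measure.le_iff.2 fun B hB => ?_
  set z := stereoInv R hR x with hz
  have hind := measurable_indicator_stereo R hB
  have hacc (y : Sph d) :
      ENNReal.ofReal (sphDensity R π y / ((n + 1) * M)) ≤ acceptMass n R h π ω z y := by
    calc _ = ∫⁻ _c, ∫⁻ _r, ENNReal.ofReal (sphDensity R π y / ((n + 1) * M))
          ∂(iid (proposalKernel d h) n y) ∂(iid (proposalKernel d h) n z) := by simp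
      _ ≤ _ := by
          refine lintegral_mono fun c => lintegral_mono fun r => ?_
          simp only
          rw [← ENNReal.ofReal_mul (mtmWeight_pos ω z y c).le, mtmWeight_mul_mtmAccept hR hpos]
          exact ENNReal.ofReal_le_ofReal (hω z y c r)
  have hG : Measurable fun y : Sph d =>
      propDensity d h (inner ℝ z.1 y.1) * B.indicator 1 (stereo R y) :=
    (measurable_propDensity_inner_right h z).mul hind
  have hps := (measurable_sphDensity R hcont).ennreal_ofReal
  have hpG : Measurable fun y : Sph d => ENNReal.ofReal (sphDensity R π y) *
      (propDensity d h (inner ℝ z.1 y.1) * B.indicator 1 (stereo R y)) := hps.mul hG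
  have h1 := hc _ hG
  simp only [stereo_stereoInv] at h1
  rw [smtmKernel_apply_eq_add hR h hcont hpos ω x hB, withDensity_apply _ hB,
    ← lintegral_indicator hB]
  -- The rejection term is dropped.
  refine le_trans ?_ le_self_add
  have hGs : Measurable fun y : Euc d => propDensity d h (inner ℝ z.1 (stereoInv R hR y).1) *
      B.indicator (1 : Euc d → ℝ≥0∞) y :=
    ((measurable_propDensity_inner_right h z).comp (measurable_stereoInv R hR)).mul
      (measurable_one.indicator hB)
  calc _ = ENNReal.ofReal M⁻¹ * (c * ∫⁻ y, propDensity d h (inner ℝ z.1 (stereoInv R hR y).1) *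
        B.indicator 1 y ∂(targetMeasure π)) := by
        rw [← mul_assoc, ← lintegral_const_mul _ hGs]
        refine lintegral_congr fun y => ?_
        by_cases hy : y ∈ B <;> simp [hy, mul_assoc]
    _ = ∫⁻ y, propDensity d h (inner ℝ z.1 y.1) * (ENNReal.ofReal M⁻¹ *
          (ENNReal.ofReal (sphDensity R π y) * B.indicator 1 (stereo R y))) ∂(surf d) := by
        rw [← h1, ← lintegral_const_mul _ hpG]
        exact lintegral_congr fun y => by ring
    _ ≤ ∫⁻ y, propDensity d h (inner ℝ z.1 y.1) * ((n + 1) *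
          (acceptMass n R h π ω z y * B.indicator 1 (stereo R y))) ∂(surf d) := by
        refine lintegral_mono fun y => ?_
        simp only [← mul_assoc]
        gcongr ?_ * _
        simp only [mul_assoc]
        gcongr _ * ?_
        rw [← ENNReal.ofReal_mul (by positivity)]
        refine le_trans (le_of_eq ?_) (mul_le_mul_right (hacc y) _)
        rw [show ((n : ℝ≥0∞) + 1) = ENNReal.ofReal (n + 1) by
          rw [ENNReal.ofReal_add (by positivity) zero_le_one]; simp,
          ← ENNReal.ofReal_mul (by positivity)]
        congr 1
        field_simp
    _ = _ := by
        have hm : Measurable fun y : Sph d =>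
            acceptMass n R h π ω z y * B.indicator 1 (stereo R y) :=
          (measurable_section (measurable_acceptMass R h hcont ω) z).mul hind
        rw [← lintegral_const_mul _ hm, proposalKernel_eq_withDensity hh,
          lintegral_withDensity_eq_lintegral_mul _
            (measurable_propDensity_inner_right h z) (hm.const_mul _)]
        rfl

end

/-! ### Geometry of the sphere -/

theorem norm_coe_sph {d : ℕ} (z : Sph d) : ‖z.1‖ = 1 := norm_eq_of_mem_sphere z

theorem inner_nrm {d : ℕ} (z : Sph d) {u : Euc (d + 1)} (hu : u ≠ 0) :
    inner ℝ z.1 (nrm u).1 = ‖u‖⁻¹ * inner ℝ z.1 u := by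
  rw [nrm_coe hu, inner_smul_right]

theorem exists_orthogonal {d : ℕ} (hd : d ≠ 0) (z : Sph d) : ∃ m : Sph d, inner ℝ z.1 m.1 = 0 := by
  have hz : z.1 ≠ 0 := norm_ne_zero_iff.1 (by rw [norm_coe_sph]; exact one_ne_zero)
  have : Fact (Module.finrank ℝ (Euc (d + 1)) = d + 1) := ⟨by simp⟩
  have hf : Module.finrank ℝ (Submodule.span ℝ {z.1})ᗮ = d :=
    Submodule.finrank_orthogonal_span_singleton hz
  have : Nontrivial (Submodule.span ℝ {z.1})ᗮ :=
    Module.nontrivial_of_finrank_pos (R := ℝ) (by omega)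
  obtain ⟨⟨u, hu⟩, hu0⟩ := exists_ne (0 : (Submodule.span ℝ {z.1})ᗮ)
  have hu0' : u ≠ 0 := fun h => hu0 (Subtype.ext h)
  refine ⟨nrm u, ?_⟩
  rw [inner_nrm z hu0', Submodule.mem_orthogonal_singleton_iff_inner_right.1 hu, mul_zero]

theorem norm_add_sq_sph {d : ℕ} (z m : Sph d) : ‖z.1 + m.1‖ ^ 2 = 2 + 2 * inner ℝ z.1 m.1 := by
  rw [norm_add_sq_real, norm_coe_sph, norm_coe_sph]
  ring

theorem inner_left_add_sph {d : ℕ} (z m : Sph d) :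
    inner ℝ z.1 (z.1 + m.1) = ‖z.1 + m.1‖ ^ 2 / 2 := by
  rw [inner_add_right, real_inner_self_eq_norm_sq, norm_coe_sph, norm_add_sq_sph]
  ring

theorem inner_midpoint {d : ℕ} (z m : Sph d) (h : z.1 + m.1 ≠ 0) :
    inner ℝ z.1 (nrm (z.1 + m.1)).1 = ‖z.1 + m.1‖ / 2 := by
  have := norm_ne_zero_iff.2 h
  rw [inner_nrm z h, inner_left_add_sph]
  field_simp

theorem inner_midpoint_right {d : ℕ} (z m : Sph d) (h : z.1 + m.1 ≠ 0) :
    inner ℝ (nrm (z.1 + m.1)).1 m.1 = ‖z.1 + m.1‖ / 2 := by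
  have h' : m.1 + z.1 = z.1 + m.1 := add_comm _ _
  have := inner_midpoint m z (h' ▸ h)
  rwa [h', real_inner_comm] at this

/-- Bisecting an angle of at most 90° leaves at most 45°, and `7 / 10` is a rational number below
`cos 45°`. -/
theorem exists_midpoint_of_inner_nonneg {d : ℕ} {z m : Sph d} (h : 0 ≤ inner ℝ z.1 m.1) :
    ∃ w : Sph d, 7 / 10 ≤ inner ℝ z.1 w.1 ∧ 7 / 10 ≤ inner ℝ w.1 m.1 := by
  have h2 := norm_add_sq_sph z m
  have h0 : z.1 + m.1 ≠ 0 := fun h0 => by rw [h0, norm_zero] at h2; linarith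
  have h7 : 7 / 10 ≤ ‖z.1 + m.1‖ / 2 := by nlinarith [norm_nonneg (z.1 + m.1)]
  refine ⟨nrm (z.1 + m.1), ?_, ?_⟩
  · rwa [inner_midpoint z m h0]
  · rwa [inner_midpoint_right z m h0]

/-- The normalized sum bisects the angle. For antipodal points it does not exist and any orthogonal
unit vector serves; this is where `d ≠ 0` enters. -/
theorem exists_midpoint {d : ℕ} (hd : d ≠ 0) (z z' : Sph d) :
    ∃ m : Sph d, 0 ≤ inner ℝ z.1 m.1 ∧ 0 ≤ inner ℝ m.1 z'.1 := by
  by_cases h : z.1 + z'.1 = 0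
  · obtain ⟨m, hm⟩ := exists_orthogonal hd z
    refine ⟨m, hm.ge, ?_⟩
    rw [eq_neg_of_add_eq_zero_right h, inner_neg_right, real_inner_comm, hm, neg_zero]
  · refine ⟨nrm (z.1 + z'.1), ?_, ?_⟩
    · rw [inner_midpoint z z' h]
      positivity
    · rw [inner_midpoint_right z z' h]
      positivity

/-- Moving each unit vector by less than `1 / 10` costs at most `1 / 10` in the inner product, and
`7 / 10 - 2 / 10 = 1 / 2` is the range where `propDensity` is bounded below. -/
theorem inner_ge_of_dist_lt {d : ℕ} {m m' w w' : Sph d} (h : 7 / 10 ≤ inner ℝ m.1 m'.1)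
    (hw : dist w m < 1 / 10) (hw' : dist w' m' < 1 / 10) : 1 / 2 ≤ inner ℝ w.1 w'.1 := by
  rw [Subtype.dist_eq, dist_eq_norm] at hw hw'
  have e : inner ℝ w.1 w'.1 =
      inner ℝ m.1 m'.1 + inner ℝ (w.1 - m.1) w'.1 + inner ℝ m.1 (w'.1 - m'.1) := by
    simp only [inner_sub_left, inner_sub_right]
    ring
  have h1 := (abs_le.1 (abs_real_inner_le_norm (w.1 - m.1) w'.1)).1
  have h2 := (abs_le.1 (abs_real_inner_le_norm m.1 (w'.1 - m'.1))).1
  rw [norm_coe_sph, mul_one] at h1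
  rw [norm_coe_sph, one_mul] at h2
  linarith

theorem inner_le_one_sph {d : ℕ} (z w : Sph d) : inner ℝ z.1 w.1 ≤ 1 := by
  have := real_inner_le_norm z.1 w.1
  rwa [norm_coe_sph, norm_coe_sph, mul_one] at this

theorem surf_ball_pos {d : ℕ} (m : Sph d) {r : ℝ} (hr : 0 < r) : 0 < surf d (Metric.ball m r) := by
  rw [surf, Measure.map_apply measurable_nrm measurableSet_ball,
    Measure.restrict_apply (measurable_nrm measurableSet_ball)]
  -- The Euclidean ball of radius `s` about `m / 2` lies inside the unit ball and away from the
  -- origin; radial projection moves its points to within `4 * s ≤ r / 2` of `m`.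
  set s := min (r / 8) (1 / 8) with hs
  have hs0 : 0 < s := by positivity
  have hsr : s ≤ r / 8 := min_le_left _ _
  have hs1 : s ≤ 1 / 8 := min_le_right _ _
  refine (Metric.measure_ball_pos volume ((1 / 2 : ℝ) • m.1) hs0).trans_le
    (measure_mono fun u hu => ?_)
  rw [mem_ball_iff_norm] at hu
  have hm : ‖(1 / 2 : ℝ) • m.1‖ = 1 / 2 := by rw [norm_smul, norm_coe_sph]; norm_num
  have h1 := abs_le.1 (abs_norm_sub_norm_le u ((1 / 2 : ℝ) • m.1))
  rw [hm] at h1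
  have hu0 : 0 < ‖u‖ := by linarith [h1.1]
  refine ⟨?_, by rw [mem_ball_zero_iff]; linarith [h1.2]⟩
  rw [Set.mem_preimage, Metric.mem_ball, Subtype.dist_eq, dist_eq_norm,
    nrm_coe (norm_pos_iff.1 hu0)]
  have e : ‖u‖⁻¹ • u - m.1 = (‖u‖⁻¹ - 2) • u + (2 : ℝ) • (u - (1 / 2 : ℝ) • m.1) := by
    module
  have e1 : ‖(‖u‖⁻¹ - 2) • u‖ = |1 - 2 * ‖u‖| := by
    rw [norm_smul, Real.norm_eq_abs]
    conv_lhs => rw [← abs_of_pos hu0, ← abs_mul, sub_mul, abs_of_pos hu0]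
    rw [inv_mul_cancel₀ hu0.ne']
  have e2 : |1 - 2 * ‖u‖| ≤ 2 * s := abs_le.2 ⟨by linarith [h1.2], by linarith [h1.1]⟩
  have e3 : ‖(2 : ℝ) • (u - (1 / 2 : ℝ) • m.1)‖ ≤ 2 * s := by
    rw [norm_smul, Real.norm_of_nonneg zero_le_two]
    linarith
  rw [e]
  refine (norm_add_le _ _).trans_lt ?_
  rw [e1]
  linarith

/-! ### Four-step minorization and uniform ergodicity -/

section

variable {d n : ℕ} {R h : ℝ} {π : Euc d → ℝ}

theorem targetMeasure_preimage_ball_pos (hd : d ≠ 0) (hR : 0 < R) (hcont : Continuous π)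
    (hpos : ∀ x, 0 < π x) (hZ : 0 < ∫ x, π x) (m : Sph d) {r : ℝ} (hr : 0 < r) :
    0 < targetMeasure π (stereoInv R hR ⁻¹' Metric.ball m r) := by
  obtain ⟨c, -, -, hc⟩ := exists_lintegral_surf_eq hd hR hcont hZ
  have hB : MeasurableSet (Metric.ball m r) := measurableSet_ball
  have h1 := hc _ (measurable_one.indicator hB)
  refine pos_iff_ne_zero.2 fun h0 => ?_
  have h2 : ∫⁻ x, (Metric.ball m r).indicator 1 (stereoInv R hR x) ∂(targetMeasure π) = 0 := by
    rw [← h0, ← lintegral_indicator_one (measurable_stereoInv R hR hB)]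
    rfl
  have hm : Measurable fun z => ENNReal.ofReal (sphDensity R π z) *
      (Metric.ball m r).indicator 1 z :=
    (measurable_sphDensity R hcont).ennreal_ofReal.mul (measurable_one.indicator hB)
  rw [h2, mul_zero, lintegral_eq_zero_iff hm] at h1
  refine (surf_ball_pos m hr).ne' (measure_mono_null (fun z hz => ?_) h1)
  have hz' : dist z m < r := hz
  simp [hz', sphDensity_pos hR hpos z]

/-- Near `m`, every ball of radius `r` contains the ball of radius `r / 2` about `m`, which has
positive mass. Compactness of the sphere makes the local bound uniform, without continuity of the
mass in the centre. -/
theorem exists_le_targetMeasure_preimage_ball (hd : d ≠ 0) (hR : 0 < R) (hcont : Continuous π)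
    (hpos : ∀ x, 0 < π x) (hZ : 0 < ∫ x, π x) {r : ℝ} (hr : 0 < r) :
    ∃ η : ℝ≥0∞, η ≠ 0 ∧ ∀ m, η ≤ targetMeasure π (stereoInv R hR ⁻¹' Metric.ball m r) := by
  have h := (isCompact_univ (X := Sph d)).induction_on
    (p := fun s => ∃ η : ℝ≥0∞, η ≠ 0 ∧
      ∀ m ∈ s, η ≤ targetMeasure π (stereoInv R hR ⁻¹' Metric.ball m r))
    ⟨1, one_ne_zero, by simp⟩ (fun s t hst ⟨η, h0, h1⟩ => ⟨η, h0, fun m hm => h1 m (hst hm)⟩)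
    (fun s t ⟨η, h0, h1⟩ ⟨η', h0', h1'⟩ => ⟨min η η', by simp [h0, h0'], fun m hm =>
      hm.elim (fun hm => (min_le_left _ _).trans (h1 m hm))
        fun hm => (min_le_right _ _).trans (h1' m hm)⟩)
    (fun m _ => ⟨Metric.ball m (r / 2), mem_nhdsWithin_of_mem_nhds
      (Metric.ball_mem_nhds m (half_pos hr)), _,
      (targetMeasure_preimage_ball_pos hd hR hcont hpos hZ m (half_pos hr)).ne', fun m' hm' =>
        measure_mono (Set.preimage_mono (Metric.ball_subset_ball' ?_))⟩)
  · obtain ⟨η, h0, h1⟩ := h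
    exact ⟨η, h0, fun m => h1 m (Set.mem_univ m)⟩
  · rw [Metric.mem_ball, dist_comm] at hm'
    linarith

/-- One step of chaining lower bounds along points of the sphere at a small distance. -/
theorem le_lintegral_of_le_on_ball {E : Type*} [MeasurableSpace E] {μ : Measure E} {s : E → Sph d}
    (hs : Measurable s) {q : E → ℝ≥0∞} {p : E → E → ℝ≥0∞} {a e η : ℝ≥0∞} {m m' : Sph d}
    (hm : 7 / 10 ≤ inner ℝ m.1 m'.1)
    (hη : η ≤ μ (s ⁻¹' Metric.ball m (1 / 10)))
    (hq : ∀ w, dist (s w) m < 1 / 10 → a ≤ q w)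
    (hp : ∀ w y, 1 / 2 ≤ inner ℝ (s w).1 (s y).1 → e ≤ p w y) {y : E}
    (hy : dist (s y) m' < 1 / 10) : a * e * η ≤ ∫⁻ w, q w * p w y ∂μ := by
  have hB : MeasurableSet (s ⁻¹' Metric.ball m (1 / 10)) := hs measurableSet_ball
  calc a * e * η ≤ a * e * μ (s ⁻¹' Metric.ball m (1 / 10)) := by gcongr
    _ = ∫⁻ _w in s ⁻¹' Metric.ball m (1 / 10), a * e ∂μ := (setLIntegral_const _ _).symm
    _ ≤ ∫⁻ w in s ⁻¹' Metric.ball m (1 / 10), q w * p w y ∂μ := by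
        refine setLIntegral_mono' hB fun w hw => ?_
        exact mul_le_mul' (hq w hw) (hp w y (inner_ge_of_dist_lt hm hw hy))
    _ ≤ _ := setLIntegral_le_lintegral _ _

theorem measurable_lintegral_mul {E : Type*} [MeasurableSpace E] (μ : Measure E) [SFinite μ]
    {q p : E → E → ℝ≥0∞} (hq : Measurable (Function.uncurry q))
    (hp : Measurable (Function.uncurry p)) :
    Measurable (Function.uncurry fun x y => ∫⁻ w, q x w * p w y ∂μ) := by
  refine Measurable.lintegral_prod_right'
    (f := fun t : (E × E) × E => q t.1.1 t.2 * p t.2 t.1.2) ?_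
  have h1 : Measurable fun t : (E × E) × E => (t.1.1, t.2) := by fun_prop
  have h2 : Measurable fun t : (E × E) × E => (t.2, t.1.2) := by fun_prop
  exact (hq.comp h1).mul (hp.comp h2)

/-- The weight function enters only through `hω`, so both balanced choices are covered at once. -/
theorem uniformlyErgodic_smtmKernel_of_weight_bound (hd : d ≠ 0) (hR : 0 < R) (hh : 0 < h)
    (hcont : Continuous π) (hpos : ∀ x, 0 < π x)
    (hbdd : BddAbove (Set.range fun x : Euc d => π x * (R ^ 2 + ‖x‖ ^ 2) ^ d))
    (ω : WeightFunction d) {M : ℝ} (hM : 0 < M)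
    (hω : ∀ (z y : Sph d) (c r : Fin n → Sph d), sphDensity R π y / ((n + 1) * M) ≤
      min (mtmWeight ω z y c) (sphDensity R π y / sphDensity R π z * mtmWeight ω y z r)) :
    UniformlyErgodic (smtmKernel (n + 1) R hR h π hcont ω) (targetMeasure π) := by
  have hint := integrable_of_bddAbove hd hR hcont hpos hbdd
  have hZ := integral_pos_of_pos hcont hpos hint
  have := isProbabilityMeasure_targetMeasure hint hpos hZ
  have := isMarkovKernel_smtmKernel (N := n + 1) R hR h π hcont hpos ω
  have hinv := (isReversible_smtmKernel (n := n) hd hR hh hcont hpos hZ ω).invariant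
  obtain ⟨b, hb, hmin⟩ := exists_withDensity_le_smtmKernel hd hR hh hcont hpos hZ ω hM hω
  obtain ⟨ε, hε, hprop⟩ := exists_propDensity_ge d hh
  obtain ⟨η, hη, hball⟩ :=
    exists_le_targetMeasure_preimage_ball hd hR hcont hpos hZ (r := 1 / 10) (by norm_num)
  set s := stereoInv (d := d) R hR
  have hs : Measurable s := measurable_stereoInv R hR
  set μ := targetMeasure π
  set p : Euc d → Euc d → ℝ≥0∞ := fun x y => b * propDensity d h (inner ℝ (s x).1 (s y).1)
  have hpm : Measurable (Function.uncurry p) :=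
    ((measurable_propDensity_inner d h).comp (hs.prodMap hs)).const_mul b
  have hpe (w y : Euc d) (hwy : 1 / 2 ≤ inner ℝ (s w).1 (s y).1) : b * ε ≤ p w y :=
    mul_le_mul' le_rfl (hprop _ hwy (inner_le_one_sph _ _))
  have hcomp {q : Euc d → Euc d → ℝ≥0∞} (hq : Measurable (Function.uncurry q)) :=
    measurable_lintegral_mul μ hq hpm
  have d1 : ∀ x, μ.withDensity (p x) ≤ (smtmKernel (n + 1) R hR h π hcont ω ^ 1) x := by
    simpa using hmin
  have d2 := withDensity_le_pow_succ hpm hpm hmin d1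
  have d3 := withDensity_le_pow_succ hpm (hcomp hpm) hmin d2
  have d4 := withDensity_le_pow_succ hpm (hcomp (hcomp hpm)) hmin d3
  refine uniformlyErgodic_of_minorization hinv (k := 4)
    -- One factor `b * ε` for each of the four steps and one `η` for each of the three intermediate
    -- balls.
    (c := b * ε * (b * ε) * η * (b * ε) * η * (b * ε) * η) (by simp [hb, hε, hη]) fun x => ?_
  refine le_trans ?_ (d4 x)
  rw [← withDensity_const]
  refine withDensity_mono (.of_forall fun y => ?_)
  -- The point `m2` is within 90° of both ends; `m1` and `m3` halve the two arcs.
  obtain ⟨m2, h2, h2'⟩ := exists_midpoint hd (s x) (s y)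
  obtain ⟨m1, h1, h12⟩ := exists_midpoint_of_inner_nonneg h2
  obtain ⟨m3, h23, h3⟩ := exists_midpoint_of_inner_nonneg h2'
  have hself (z : Sph d) : dist z z < 1 / 10 := by rw [dist_self]; norm_num
  refine le_lintegral_of_le_on_ball hs h3 (hball m3) (fun w hw => ?_) hpe (hself _)
  refine le_lintegral_of_le_on_ball hs h23 (hball m2) (fun w hw => ?_) hpe hw
  refine le_lintegral_of_le_on_ball hs h12 (hball m1) (fun w hw => ?_) hpe hw
  exact hpe _ _ (inner_ge_of_dist_lt h1 (hself _) hw)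

theorem uniformlyErgodic_of_subsingleton {α : Type*} [MeasurableSpace α] [Subsingleton α]
    (κ : Kernel α α) [IsMarkovKernel κ] (μ : Measure α) [IsProbabilityMeasure μ] :
    UniformlyErgodic κ μ := by
  refine fun ε hε => ⟨1, fun x => ?_⟩
  rw [pow_one]
  refine (tvDist_le_of_forall_le le_rfl fun A _ => ?_).trans hε.le
  rcases A.eq_empty_or_nonempty with rfl | hA
  · simp
  · simp [Subsingleton.eq_univ_of_nonempty hA]

theorem uniformlyErgodic_smtmKernel_zero {π : Euc 0 → ℝ} (N : ℕ) [NeZero N] (hR : 0 < R)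
    (hcont : Continuous π) (hpos : ∀ x, 0 < π x) (ω : WeightFunction 0) :
    UniformlyErgodic (smtmKernel N R hR h π hcont ω) (targetMeasure π) := by
  have hint : Integrable π :=
    hcont.integrable_of_hasCompactSupport (HasCompactSupport.of_compactSpace _)
  have := isProbabilityMeasure_targetMeasure hint hpos (integral_pos_of_pos hcont hpos hint)
  have := isMarkovKernel_smtmKernel (N := N) R hR h π hcont hpos ω
  exact uniformlyErgodic_of_subsingleton _ _

/-! ### The balanced weights -/

theorem sum_add_le {f : Sph d → ℝ} {K : ℝ} (hf : ∀ z, f z ≤ K) (c : Fin n → Sph d) (y : Sph d) :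
    ∑ i, f (c i) + f y ≤ (n + 1) * K := by
  have h1 : ∑ i, f (c i) ≤ n * K := by
    simpa using Finset.sum_le_card_nsmul Finset.univ (fun i => f (c i)) K fun i _ => hf _
  linarith [hf y]

theorem mtmWeight_globallyBalanced (hR : 0 < R) (hcont : Continuous π) (hpos : ∀ x, 0 < π x)
    (z y : Sph d) (c : Fin n → Sph d) :
    mtmWeight (globallyBalanced R hR π hcont hpos) z y c =
      sphDensity R π y / (∑ i, sphDensity R π (c i) + sphDensity R π y) := by
  have hz := sphDensity_pos hR hpos z
  simp only [mtmWeight, globallyBalanced]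
  rw [← Finset.sum_div, ← add_div, div_div_div_cancel_right₀ hz.ne']

theorem mtmWeight_locallyBalanced (hR : 0 < R) (hcont : Continuous π) (hpos : ∀ x, 0 < π x)
    (z y : Sph d) (c : Fin n → Sph d) :
    mtmWeight (locallyBalanced R hR π hcont hpos) z y c =
      √(sphDensity R π y) / (∑ i, √(sphDensity R π (c i)) + √(sphDensity R π y)) := by
  have hz := Real.sqrt_pos.2 (sphDensity_pos hR hpos z)
  simp only [mtmWeight, locallyBalanced, Real.sqrt_div (sphDensity_pos hR hpos _).le]
  rw [← Finset.sum_div, ← add_div, div_div_div_cancel_right₀ hz.ne']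

/-- The normalization by the current point cancels: both terms become `π_S(y)` over a sum of `n + 1`
values of `π_S`, each at most `M`. -/
theorem globallyBalanced_bound (hR : 0 < R) (hcont : Continuous π) (hpos : ∀ x, 0 < π x) {M : ℝ}
    (hM : ∀ z : Sph d, sphDensity R π z ≤ M) (z y : Sph d) (c r : Fin n → Sph d) :
    sphDensity R π y / ((n + 1) * M) ≤
      min (mtmWeight (globallyBalanced R hR π hcont hpos) z y c)
        (sphDensity R π y / sphDensity R π z *
          mtmWeight (globallyBalanced R hR π hcont hpos) y z r) := by
  have hp := sphDensity_pos (d := d) hR hpos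
  have hsum (c : Fin n → Sph d) (y : Sph d) :
      0 < ∑ i, sphDensity R π (c i) + sphDensity R π y :=
    add_pos_of_nonneg_of_pos (Finset.sum_nonneg fun _ _ => (hp _).le) (hp _)
  have hb (c : Fin n → Sph d) (w : Sph d) : sphDensity R π y / ((n + 1) * M) ≤
      sphDensity R π y / (∑ i, sphDensity R π (c i) + sphDensity R π w) :=
    div_le_div_of_nonneg_left (hp y).le (hsum c w) (sum_add_le hM c w)
  rw [mtmWeight_globallyBalanced, mtmWeight_globallyBalanced,
    div_mul_div_cancel₀ (hp z).ne']
  exact le_min (hb c y) (hb r z)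

/-- With `f = √π_S`, both terms are `f(y)²` over one value of `f` times a sum of `n + 1` values. The
two factors `√M` combine to the same bound as for the global weight. -/
theorem locallyBalanced_bound (hR : 0 < R) (hcont : Continuous π) (hpos : ∀ x, 0 < π x) {M : ℝ}
    (hM : ∀ z : Sph d, sphDensity R π z ≤ M) (z y : Sph d) (c r : Fin n → Sph d) :
    sphDensity R π y / ((n + 1) * M) ≤
      min (mtmWeight (locallyBalanced R hR π hcont hpos) z y c)
        (sphDensity R π y / sphDensity R π z *
          mtmWeight (locallyBalanced R hR π hcont hpos) y z r) := by
  set f : Sph d → ℝ := fun z => √(sphDensity R π z) with hf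
  have hp (z : Sph d) : 0 < f z := Real.sqrt_pos.2 (sphDensity_pos hR hpos z)
  have hsq (z : Sph d) : sphDensity R π z = f z * f z :=
    (Real.mul_self_sqrt (sphDensity_pos hR hpos z).le).symm
  have hfM (z : Sph d) : f z ≤ √M := Real.sqrt_le_sqrt (hM z)
  have hM2 : √M * √M = M := Real.mul_self_sqrt ((sphDensity_pos hR hpos z).le.trans (hM z))
  have hsum (c : Fin n → Sph d) (y : Sph d) : 0 < ∑ i, f (c i) + f y :=
    add_pos_of_nonneg_of_pos (Finset.sum_nonneg fun _ _ => (hp _).le) (hp _)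
  have hb (c : Fin n → Sph d) (v w : Sph d) : sphDensity R π y / ((n + 1) * M) ≤
      f y * f y / (f v * (∑ i, f (c i) + f w)) := by
    rw [hsq y]
    refine div_le_div_of_nonneg_left (mul_pos (hp y) (hp y)).le (mul_pos (hp v) (hsum c w)) ?_
    calc f v * (∑ i, f (c i) + f w) ≤ √M * ((n + 1) * √M) :=
          mul_le_mul (hfM v) (sum_add_le hfM c w) (hsum c w).le (Real.sqrt_nonneg M)
      _ = (n + 1) * M := by rw [mul_left_comm, hM2]
  rw [mtmWeight_locallyBalanced, mtmWeight_locallyBalanced]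
  refine le_min ?_ ?_
  -- Here `f y / S` is read as `f y * f y / (f y * S)`, with `S` the sum of the values of `f`.
  · refine (hb c y y).trans_eq ?_
    rw [mul_div_mul_left _ _ (hp y).ne']
  · refine (hb r z z).trans_eq ?_
    change _ = sphDensity R π y / sphDensity R π z * (f z / (∑ i, f (r i) + f z))
    rw [hsq y, hsq z]
    have := (hp z).ne'
    have := (hsum r z).ne'
    field_simp

end

end SMTM

theorem mainTheorem1 (d N : ℕ) [NeZero N] (R : ℝ) (hR : 0 < R) (h : ℝ) (hh : 0 < h)
    (π : SMTM.Euc d → ℝ) (hcont : Continuous π) (hpos : ∀ x, 0 < π x)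
    (hbdd : BddAbove (Set.range fun x : SMTM.Euc d => π x * (R ^ 2 + ‖x‖ ^ 2) ^ d)) :
    SMTM.UniformlyErgodic
        (SMTM.smtmKernel N R hR h π hcont (SMTM.globallyBalanced R hR π hcont hpos))
        (SMTM.targetMeasure π) ∧
      SMTM.UniformlyErgodic
        (SMTM.smtmKernel N R hR h π hcont (SMTM.locallyBalanced R hR π hcont hpos))
        (SMTM.targetMeasure π) := by
  rcases eq_or_ne d 0 with rfl | hd
  · exact ⟨SMTM.uniformlyErgodic_smtmKernel_zero N hR hcont hpos _,
      SMTM.uniformlyErgodic_smtmKernel_zero N hR hcont hpos _⟩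
  obtain ⟨M, hM0, hM⟩ := SMTM.exists_sphDensity_le hbdd
  -- Writing `N` as a successor makes the `N - 1` balancing points and the `n` unselected candidates
  -- families over the same index type.
  obtain ⟨n, rfl⟩ := Nat.exists_eq_succ_of_ne_zero (NeZero.ne N)
  exact ⟨SMTM.uniformlyErgodic_smtmKernel_of_weight_bound hd hR hh hcont hpos hbdd _ hM0
      (SMTM.globallyBalanced_bound hR hcont hpos hM),
    SMTM.uniformlyErgodic_smtmKernel_of_weight_bound hd hR hh hcont hpos hbdd _ hM0
      (SMTM.locallyBalanced_bound hR hcont hpos hM)⟩
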